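/- Let $n\ge 1$ and $s\in(0,\tfrac12)$. For $z\in\mathbb R^n$ and $t>0$ let $$P^s(z,t)=\frac1{(2\pi)^n}\int_{\mathbb R^n}e^{i\xi\cdot z}\,e^{-t|\xi|^{2s}}\,d\xi$$ be the fractional heat kernel, and for a Lebesgue measurable set $E\subset\mathbb R^n$, with $E^c=\mathbb R^n\setminus E$, define, with values in $[0,+\infty]$, $$\mathcal E^s_t(E)=\int_E\int_{E^c}P^s(x-y,t)\,dy\,dx,\qquad \mathrm P_{2s}(E)=\int_E\int_{E^c}\frac{1}{|x-y|^{n+2s}}\,dx\,dy .$$ Write $(-\Delta)^su(x)=C_{n,s}\int_{\mathbb R^n}\frac{u(x)-u(y)}{|x-y|^{n+2s}}\,dy$ with $C_{n,s}=\left(\int_{\mathbb R^n}\frac{1-\cos h_1}{|h|^{n+2s}}\,dh\right)^{-1}$. Then $P^s$ is a fundamental solution of the fractional heat equation, that is: $P^s(\cdot,t)\ge 0$ is integrable with $\int_{\mathbb R^n}P^s(z,t)\,dz=1$ for all $t>0$; $\partial_tP^s+(-\Delta)^sP^s=0$ pointwise on $\mathbb R^n\times(0,\infty)$, the integral defining $(-\Delta)^sP^s$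 being absolutely convergent; and $P^s(\cdot,t)\to\delta_0$ as $t\to0^+$, in the sense that $\int_{\mathbb R^n}P^s(z,t)\varphi(z)\,dz\to\varphi(0)$ for every bounded continuous $\varphi:\mathbb R^n\to\mathbb R$. Moreover, for every Lebesgue measurable set $E\subset\mathbb R^n$, $$\limsup_{t\to0^+}\frac{\mathcal E^s_t(E)}{t}<+\infty\quad\Longleftrightarrow\quad \mathrm P_{2s}(E)<+\infty .$$ -/

import Mathlib

open MeasureTheory Filter Topology

noncomputable section

/-- The fractional heat kernel `P^s(z,t)` on `ℝⁿ`: the inverse Fourier transform of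
`ξ ↦ exp (-t |ξ|^{2s})`, i.e. `(2π)⁻ⁿ ∫ e^{i ξ·z} e^{-t|ξ|^{2s}} dξ`. The integrand has an odd
imaginary part, so only its real part is kept. -/
def fracHeatKernel (n : ℕ) (s : ℝ) (z : EuclideanSpace ℝ (Fin n)) (t : ℝ) : ℝ :=
  ((2 * Real.pi) ^ n)⁻¹ *
    ∫ ξ : EuclideanSpace ℝ (Fin n), Real.cos (inner ℝ ξ z) * Real.exp (-t * ‖ξ‖ ^ (2 * s))

/-- The normalizing constant `C_{n,s} = (∫ (1 - cos h₁) / |h|^{n+2s} dh)⁻¹`. -/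
def fracLaplacianConst (n : ℕ) [NeZero n] (s : ℝ) : ℝ :=
  (∫ h : EuclideanSpace ℝ (Fin n), (1 - Real.cos (h 0)) / ‖h‖ ^ ((n : ℝ) + 2 * s))⁻¹

/-- The fractional Laplacian `(-Δ)^s u (x) = C_{n,s} ∫ (u(x) - u(y)) / |x-y|^{n+2s} dy`. It is used
below only where the integral converges absolutely. -/
def fracLaplacian (n : ℕ) [NeZero n] (s : ℝ) (u : EuclideanSpace ℝ (Fin n) → ℝ)
    (x : EuclideanSpace ℝ (Fin n)) : ℝ :=
  fracLaplacianConst n s *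
    ∫ y : EuclideanSpace ℝ (Fin n), (u x - u y) / ‖x - y‖ ^ ((n : ℝ) + 2 * s)

/-- `P` is a (nonnegative) fundamental solution of the fractional heat equation:
`∂ₜ P + (-Δ)^s P = 0` for `t > 0`, `P(·,0) = δ₀`, and `∫ P(z,t) dz = 1`. The initial condition means
weak convergence of `P(z,t) dz` to the Dirac mass at the origin as `t → 0⁺`. -/
structure IsFracHeatFundamentalSolution (n : ℕ) [NeZero n] (s : ℝ)
    (P : EuclideanSpace ℝ (Fin n) → ℝ → ℝ) : Prop where
  nonneg : ∀ t : ℝ, 0 < t → ∀ z, 0 ≤ P z t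
  integrable : ∀ t : ℝ, 0 < t → Integrable (fun z => P z t) volume
  integral_eq_one : ∀ t : ℝ, 0 < t → ∫ z, P z t = 1
  integrable_fracLaplacian : ∀ t : ℝ, 0 < t → ∀ z,
    Integrable (fun y => (P z t - P y t) / ‖z - y‖ ^ ((n : ℝ) + 2 * s)) volume
  equation : ∀ t : ℝ, 0 < t → ∀ z,
    HasDerivAt (fun τ => P z τ) (-fracLaplacian n s (fun y => P y t) z) t
  initial : ∀ φ : BoundedContinuousFunction (EuclideanSpace ℝ (Fin n)) ℝ,
    Tendsto (fun t : ℝ => ∫ z, P z t * φ z) (𝓝[>] 0) (𝓝 (φ 0))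

/-- The energy `𝓔ₜˢ(E) = ∫_E ∫_{Eᶜ} P^s(x-y,t) dy dx`, with values in `[0,∞]`. -/
def fracHeatEnergy (n : ℕ) (s t : ℝ) (E : Set (EuclideanSpace ℝ (Fin n))) : ENNReal :=
  ∫⁻ x in E, ∫⁻ y in Eᶜ, ENNReal.ofReal (fracHeatKernel n s (x - y) t)

/-- The `2s`-fractional perimeter `P_{2s}(E) = ∫_E ∫_{Eᶜ} |x-y|^{-(n+2s)} dx dy`, with values in
`[0,∞]`. -/
def fracPerimeter (n : ℕ) (s : ℝ) (E : Set (EuclideanSpace ℝ (Fin n))) : ENNReal :=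
  ∫⁻ y in E, ∫⁻ x in Eᶜ, ENNReal.ofReal (1 / ‖x - y‖ ^ ((n : ℝ) + 2 * s))

end

/-!
The proof rests on three facts about `P^s`: it is nonnegative and radially nonincreasing, it is
self-similar, and it is comparable with `t / |z|^{n+2s}` once `t` is small compared with `|z|^{2s}`.

*Sign and monotonicity.* Both hold for every Gaussian and survive averaging and pointwise limits, so
it suffices to write `e^{-t|ξ|^{2s}}` as a limit of averages of `e^{-u|ξ|²}`. The averages are over
the laws of normalized sums of independent Pareto variables, which converge to the `s`-stable law: the
`m`-th power of the Pareto Laplace transform, evaluated at `(t / (κ m))^{1/s} |ξ|²`, tends to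
`e^{-t|ξ|^{2s}}` (`tendsto_paretoLaplace_pow`). No measure on the half-line is needed: multiplying a
multiplier by a Laplace transform in `|ξ|²` averages its Gaussian regularizations
(`IsUnimodalMultiplier.mul_paretoLaplace`). The outcome is `isRadiallyUnimodal_cosTransform_exp_neg`.

*Total mass and bounds.* Testing the kernel against Gaussians and applying Fubini
(`integral_cosTransform_mul_gaussian`) gives `∫ P^s = 1` as the Gaussians flatten, and shows that
`∫ P^s(w,t) (1 - e^{-|w|²}) dw` is comparable with `t` for `t ≤ 1`. With monotonicity, the upper
half bounds `P^s(w,t)` by `C t` on the unit sphere, and scaling spreads this to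
`P^s(z,t) ≤ C t / |z|^{n+2s}` (`exists_fracHeatKernel_le`). This bound forces a fixed proportion of
the integral onto a fixed annulus, so the lower half yields `P^s(z,t) ≥ c t` near the origin and, by
scaling, `P^s(z,t) ≥ c t / |z|^{n+2s}` for small `t` (`exists_eventually_le_fracHeatKernel`).

*The equation.* Since `2s < 1`, the function `min(1, |h|) / |h|^{n+2s}` is integrable, so Fubini
applies to `(-Δ)^s P^s` without principal values. Plane waves are eigenfunctions with eigenvalue
`|ξ|^{2s}` by rotation and dilation invariance, and differentiation in `t` under the integral sign
gives the same expression up to sign. The initial condition follows from scaling and dominated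
convergence.

*The equivalence.* The upper bound gives `𝓔ₜˢ(E) ≤ C t P_{2s}(E)` for all `t`. Conversely, the lower
bound and Fatou's lemma give `c P_{2s}(E) ≤ liminf 𝓔ₜˢ(E) / t`.
-/

/-! ### Integrability of radial functions and the Gaussian cosine transform -/

section InnerProductSpacePrelim

variable {E : Type*} [NormedAddCommGroup E] [InnerProductSpace ℝ E] [FiniteDimensional ℝ E]
  [MeasurableSpace E] [BorelSpace E]

theorem integrable_norm_rpow_mul_exp_neg [Nontrivial E] {t p q : ℝ} (ht : 0 < t) (hp : 0 < p)
    (hq : 0 ≤ q) :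
    Integrable (fun ξ : E => ‖ξ‖ ^ q * Real.exp (-t * ‖ξ‖ ^ p)) := by
  rw [integrable_fun_norm_addHaar (volume : Measure E)
    (f := fun y : ℝ => y ^ q * Real.exp (-t * y ^ p))]
  have hd : (0 : ℝ) ≤ ((Module.finrank ℝ E - 1 : ℕ) : ℝ) := Nat.cast_nonneg _
  refine (integrableOn_rpow_mul_exp_neg_mul_rpow
    (s := ((Module.finrank ℝ E - 1 : ℕ) : ℝ) + q) (by linarith) hp ht).congr_fun
    (fun y hy => ?_) measurableSet_Ioi
  have hy : (0 : ℝ) < y := hy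
  simp only [smul_eq_mul]
  rw [Real.rpow_add hy, Real.rpow_natCast, mul_assoc]

theorem integrable_exp_neg_mul_norm_rpow [Nontrivial E] {t p : ℝ} (ht : 0 < t) (hp : 0 < p) :
    Integrable (fun ξ : E => Real.exp (-t * ‖ξ‖ ^ p)) := by
  simpa using integrable_norm_rpow_mul_exp_neg (E := E) ht hp le_rfl

theorem integrable_exp_neg_mul_norm_sq {b : ℝ} (hb : 0 < b) :
    Integrable (fun ξ : E => Real.exp (-b * ‖ξ‖ ^ 2)) := by
  have h := (GaussianFourier.integrable_cexp_neg_mul_sq_norm_add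
    (b := (b : ℂ)) (by simpa using hb) 0 (0 : E)).re
  refine h.congr (Eventually.of_forall fun ξ => ?_)
  have : (-(b : ℂ) * (‖ξ‖ : ℂ) ^ 2 + 0 * ((inner ℝ (0 : E) ξ : ℝ) : ℂ))
      = ((-b * ‖ξ‖ ^ 2 : ℝ) : ℂ) := by push_cast; ring
  simp only [this]
  rw [RCLike.re_eq_complex_re, Complex.exp_ofReal_re]

theorem integrable_min_one_norm_div_rpow [Nontrivial E] {a : ℝ}
    (h0 : (Module.finrank ℝ E : ℝ) < a) (h1 : a < Module.finrank ℝ E + 1) :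
    Integrable (fun h : E => min 1 ‖h‖ / ‖h‖ ^ a) := by
  rw [integrable_fun_norm_addHaar (volume : Measure E) (f := fun y : ℝ => min 1 y / y ^ a)]
  have hpos : 0 < Module.finrank ℝ E := Module.finrank_pos
  have hd : ((Module.finrank ℝ E - 1 : ℕ) : ℝ) = (Module.finrank ℝ E : ℝ) - 1 := by
    rw [Nat.cast_sub hpos]; simp
  rw [← Set.Ioc_union_Ioi_eq_Ioi (zero_le_one' ℝ)]
  refine IntegrableOn.union ?_ ?_
  · have : IntegrableOn (fun y : ℝ => y ^ ((Module.finrank ℝ E : ℝ) - a)) (Set.Ioc 0 1) := by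
      rw [← intervalIntegrable_iff_integrableOn_Ioc_of_le zero_le_one]
      exact intervalIntegral.intervalIntegrable_rpow' (by linarith)
    refine this.congr_fun (fun y hy => ?_) measurableSet_Ioc
    have hy0 : (0 : ℝ) < y := hy.1
    simp only [smul_eq_mul]
    rw [min_eq_right hy.2, ← Real.rpow_natCast, hd, Real.rpow_sub hy0, Real.rpow_sub hy0,
      Real.rpow_one]
    field_simp
  · refine (integrableOn_Ioi_rpow_of_lt (a := (Module.finrank ℝ E : ℝ) - 1 - a) (by linarith)
      zero_lt_one).congr_fun (fun y hy => ?_) measurableSet_Ioi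
    have hy1 : (1 : ℝ) < y := hy
    simp only [smul_eq_mul]
    rw [min_eq_left hy1.le, ← Real.rpow_natCast, hd, Real.rpow_sub (by linarith)]
    field_simp

theorem integral_cos_inner_mul_gaussian {b : ℝ} (hb : 0 < b) (z : E) :
    ∫ ξ : E, Real.cos (inner ℝ ξ z) * Real.exp (-b * ‖ξ‖ ^ 2) =
      (Real.pi / b) ^ ((Module.finrank ℝ E : ℝ) / 2) * Real.exp (-‖z‖ ^ 2 / (4 * b)) := by
  have hb' : 0 < (b : ℂ).re := by simpa using hb
  have h := GaussianFourier.integral_cexp_neg_mul_sq_norm_add hb' Complex.I z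
  have hint := GaussianFourier.integrable_cexp_neg_mul_sq_norm_add hb' Complex.I z
  have h2 := congrArg Complex.re h
  rw [← RCLike.re_eq_complex_re, ← integral_re hint] at h2
  have hR : ((Real.pi : ℂ) / b) ^ ((Module.finrank ℝ E : ℂ) / 2) *
      Complex.exp (Complex.I ^ 2 * (‖z‖ : ℂ) ^ 2 / (4 * b)) =
      (((Real.pi / b) ^ ((Module.finrank ℝ E : ℝ) / 2) *
        Real.exp (-‖z‖ ^ 2 / (4 * b)) : ℝ) : ℂ) := by
    push_cast
    rw [Complex.ofReal_cpow (by positivity)]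
    push_cast
    simp [Complex.I_sq]
  rw [hR, RCLike.re_eq_complex_re, Complex.ofReal_re] at h2
  rw [← h2]
  refine integral_congr_ae (Eventually.of_forall fun ξ => ?_)
  simp only
  have : (-(b : ℂ) * (‖ξ‖ : ℂ) ^ 2 + Complex.I * ((inner ℝ z ξ : ℝ) : ℂ))
      = ((-b * ‖ξ‖ ^ 2 : ℝ) : ℂ) + ((inner ℝ z ξ : ℝ) : ℂ) * Complex.I := by push_cast; ring
  rw [this, Complex.exp_add, ← Complex.ofReal_exp, Complex.exp_mul_I, ← Complex.ofReal_cos,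
    ← Complex.ofReal_sin, real_inner_comm z ξ]
  simp only [Complex.re_ofReal_mul, Complex.add_re, Complex.ofReal_re, Complex.mul_I_re,
    Complex.ofReal_im]
  ring

theorem integral_exp_neg_mul_norm_sq {b : ℝ} (hb : 0 < b) :
    ∫ ξ : E, Real.exp (-b * ‖ξ‖ ^ 2) = (Real.pi / b) ^ ((Module.finrank ℝ E : ℝ) / 2) := by
  simpa using integral_cos_inner_mul_gaussian hb (0 : E)

end InnerProductSpacePrelim

/-! ### The Laplace transform of the Pareto distribution -/

/-- The Laplace transform `x ↦ ∫₁^∞ e^{-xu} s u^{-1-s} du` of the Pareto distribution with tail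
exponent `s`. -/
noncomputable def paretoLaplace (s x : ℝ) : ℝ :=
  ∫ u in Set.Ioi (1 : ℝ), Real.exp (-(x * u)) * (s * u ^ (-1 - s))

/-- The constant `∫₀^∞ (1 - e^{-v}) s v^{-1-s} dv`. -/
noncomputable def stableConst (s : ℝ) : ℝ :=
  ∫ v in Set.Ioi (0 : ℝ), (1 - Real.exp (-v)) * (s * v ^ (-1 - s))

theorem integrableOn_pareto {s : ℝ} (hs : 0 < s) :
    IntegrableOn (fun u : ℝ => s * u ^ (-1 - s)) (Set.Ioi 1) :=
  (integrableOn_Ioi_rpow_of_lt (by linarith) zero_lt_one).const_mul s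

theorem integral_pareto {s : ℝ} (hs : 0 < s) :
    ∫ u in Set.Ioi (1 : ℝ), s * u ^ (-1 - s) = 1 := by
  rw [integral_const_mul, integral_Ioi_rpow_of_lt (by linarith) zero_lt_one]
  have : -1 - s + 1 ≠ 0 := by linarith
  simp only [Real.one_rpow]
  field_simp
  ring

theorem integrableOn_stableConst {s : ℝ} (hs : 0 < s) (hs1 : s < 1) :
    IntegrableOn (fun v : ℝ => (1 - Real.exp (-v)) * (s * v ^ (-1 - s))) (Set.Ioi 0) := by
  have hmeas : Measurable (fun v : ℝ => (1 - Real.exp (-v)) * (s * v ^ (-1 - s))) := by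
    fun_prop
  rw [← Set.Ioc_union_Ioi_eq_Ioi (zero_le_one' ℝ)]
  refine IntegrableOn.union ?_ ?_
  · have : IntegrableOn (fun y : ℝ => s * y ^ (-s)) (Set.Ioc 0 1) := by
      rw [← intervalIntegrable_iff_integrableOn_Ioc_of_le zero_le_one]
      exact (intervalIntegral.intervalIntegrable_rpow' (by linarith)).const_mul s
    refine Integrable.mono' this hmeas.aestronglyMeasurable ?_
    filter_upwards [ae_restrict_mem measurableSet_Ioc] with v hv
    have hv0 : 0 < v := hv.1
    have h1 : 1 - Real.exp (-v) ≤ v := by linarith [Real.add_one_le_exp (-v)]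
    have h2 : 0 ≤ 1 - Real.exp (-v) := by
      have := Real.exp_le_one_iff.2 (by linarith : -v ≤ 0); linarith
    have h3 : v ^ (-s) = v * v ^ (-1 - s) := by
      rw [show -s = 1 + (-1 - s) by ring, Real.rpow_add hv0, Real.rpow_one]
    rw [Real.norm_of_nonneg (by positivity), h3]
    have h4 : 0 ≤ s * v ^ (-1 - s) := by positivity
    nlinarith
  · refine Integrable.mono' (integrableOn_pareto hs) hmeas.aestronglyMeasurable ?_
    filter_upwards [ae_restrict_mem measurableSet_Ioi] with v hv
    have hv0 : (0 : ℝ) < v := zero_lt_one.trans hv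
    have h2 : 0 ≤ 1 - Real.exp (-v) := by
      have := Real.exp_le_one_iff.2 (by linarith : -v ≤ 0); linarith
    have h4 : 0 ≤ s * v ^ (-1 - s) := by positivity
    rw [Real.norm_of_nonneg (by positivity)]
    nlinarith [Real.exp_pos (-v)]

theorem stableConst_pos {s : ℝ} (hs : 0 < s) (hs1 : s < 1) : 0 < stableConst s := by
  have hpos : ∀ v ∈ Set.Ioi (0 : ℝ), 0 < (1 - Real.exp (-v)) * (s * v ^ (-1 - s)) := by
    intro v hv
    have hv : (0 : ℝ) < v := hv
    have : Real.exp (-v) < 1 := Real.exp_lt_one_iff.2 (by linarith)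
    have : 0 < 1 - Real.exp (-v) := by linarith
    positivity
  rw [stableConst, setIntegral_pos_iff_support_of_nonneg_ae _ (integrableOn_stableConst hs hs1)]
  · have : Set.Ioi (0 : ℝ) ⊆
        Function.support (fun v : ℝ => (1 - Real.exp (-v)) * (s * v ^ (-1 - s))) :=
      fun v hv => (hpos v hv).ne'
    rw [Set.inter_eq_self_of_subset_right this]
    simp
  · filter_upwards [ae_restrict_mem measurableSet_Ioi] with v hv using (hpos v hv).le

theorem integrableOn_paretoLaplace {s x : ℝ} (hs : 0 < s) (hx : 0 ≤ x) :
    IntegrableOn (fun u : ℝ => Real.exp (-(x * u)) * (s * u ^ (-1 - s))) (Set.Ioi 1) := by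
  refine Integrable.mono' (integrableOn_pareto hs) (by fun_prop) ?_
  filter_upwards [ae_restrict_mem measurableSet_Ioi] with u hu
  have hu0 : (0 : ℝ) < u := zero_lt_one.trans hu
  have h4 : 0 ≤ s * u ^ (-1 - s) := by positivity
  rw [Real.norm_of_nonneg (by positivity)]
  have : Real.exp (-(x * u)) ≤ 1 := Real.exp_le_one_iff.2 (by nlinarith)
  nlinarith

theorem paretoLaplace_nonneg {s : ℝ} (hs : 0 < s) (x : ℝ) : 0 ≤ paretoLaplace s x := by
  refine setIntegral_nonneg measurableSet_Ioi fun u hu => ?_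
  have hu0 : (0 : ℝ) < u := zero_lt_one.trans hu
  positivity

theorem paretoLaplace_le_one {s x : ℝ} (hs : 0 < s) (hx : 0 ≤ x) : paretoLaplace s x ≤ 1 := by
  rw [← integral_pareto hs]
  refine setIntegral_mono_on (integrableOn_paretoLaplace hs hx) (integrableOn_pareto hs)
    measurableSet_Ioi fun u hu => ?_
  have hu0 : (0 : ℝ) < u := zero_lt_one.trans hu
  have h4 : 0 ≤ s * u ^ (-1 - s) := by positivity
  have : Real.exp (-(x * u)) ≤ 1 := Real.exp_le_one_iff.2 (by nlinarith)
  nlinarith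

theorem measurable_paretoLaplace (s : ℝ) : Measurable (paretoLaplace s) := by
  have h : StronglyMeasurable (Function.uncurry fun x u : ℝ =>
      Real.exp (-(x * u)) * (s * u ^ (-1 - s))) := by
    apply Measurable.stronglyMeasurable
    unfold Function.uncurry
    fun_prop
  exact (h.integral_prod_right (ν := volume.restrict (Set.Ioi (1 : ℝ)))).measurable

/-- The substitution `v = y u` exhibits the factor `y^s` in the small-argument behaviour of the Pareto
Laplace transform; the remaining integral tends to `stableConst s` as `y → 0⁺`. -/
theorem one_sub_paretoLaplace {s y : ℝ} (hs : 0 < s) (hy : 0 < y) :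
    1 - paretoLaplace s y =
      y ^ s * ∫ v in Set.Ioi y, (1 - Real.exp (-v)) * (s * v ^ (-1 - s)) := by
  have h := integral_comp_mul_left_Ioi
    (fun v : ℝ => (1 - Real.exp (-v)) * (s * v ^ (-1 - s))) 1 hy
  rw [mul_one, smul_eq_mul] at h
  have h2 : ∫ v in Set.Ioi y, (1 - Real.exp (-v)) * (s * v ^ (-1 - s)) =
      y * ∫ u in Set.Ioi (1 : ℝ), (1 - Real.exp (-(y * u))) * (s * (y * u) ^ (-1 - s)) := by
    rw [h, mul_inv_cancel_left₀ hy.ne']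
  have h1 := integral_pareto hs
  rw [h2, paretoLaplace]
  nth_rw 1 [← h1]
  rw [← integral_sub (integrableOn_pareto hs)
    (integrableOn_paretoLaplace hs hy.le), ← integral_const_mul, ← integral_const_mul]
  refine setIntegral_congr_fun measurableSet_Ioi fun u hu => ?_
  have hu0 : (0 : ℝ) < u := zero_lt_one.trans hu
  have h3 : y ^ s * (y * y ^ (-1 - s)) = 1 := by
    rw [← mul_assoc, mul_comm (y ^ s) y, mul_assoc, ← Real.rpow_add hy,
      show s + (-1 - s) = -1 by ring, Real.rpow_neg_one]
    field_simp
  rw [Real.mul_rpow hy.le hu0.le]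
  linear_combination (-(s * u ^ (-1 - s) * (1 - Real.exp (-(y * u))))) * h3

/-- The stable limit theorem for Pareto sums, on the level of Laplace transforms: with the scaling
`(t / (κ m))^{1/s}`, the `m`-th power of the Pareto Laplace transform tends to `e^{-t x^s}`. -/
theorem tendsto_paretoLaplace_pow {s t x : ℝ} (hs : 0 < s) (hs1 : s < 1) (ht : 0 < t)
    (hx : 0 < x) :
    Tendsto (fun m : ℕ => paretoLaplace s ((t / (stableConst s * m)) ^ s⁻¹ * x) ^ m) atTop
      (𝓝 (Real.exp (-t * x ^ s))) := by
  have hκ := stableConst_pos hs hs1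
  set I : ℝ → ℝ := fun y => ∫ v in Set.Ioi y, (1 - Real.exp (-v)) * (s * v ^ (-1 - s)) with hI
  set c : ℕ → ℝ := fun m => (t / (stableConst s * m)) ^ s⁻¹ with hc
  have hc0 : Tendsto c atTop (𝓝 0) := by
    have h1 : Tendsto (fun m : ℕ => t / (stableConst s * m)) atTop (𝓝 0) :=
      tendsto_const_nhds.div_atTop
        (tendsto_natCast_atTop_atTop.const_mul_atTop hκ)
    have h2 := h1.rpow_const (p := s⁻¹) (Or.inr (by positivity))
    rwa [Real.zero_rpow (by positivity)] at h2
  have hIlim : Tendsto (fun m => I (c m * x)) atTop (𝓝 (stableConst s)) := by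
    have h0 : Tendsto (fun m => c m * x) atTop (𝓝 0) := by simpa using hc0.mul_const x
    have hcov := aecover_Ioi_of_Ioi (μ := (volume : Measure ℝ)) h0
    have := hcov.integral_tendsto_of_countably_generated (integrableOn_stableConst hs hs1)
    refine this.congr' ?_
    filter_upwards [eventually_gt_atTop 0] with m hm
    have hcm : 0 ≤ c m * x := by positivity
    rw [Measure.restrict_restrict measurableSet_Ioi,
      Set.inter_eq_self_of_subset_left (Set.Ioi_subset_Ioi hcm)]
  have key : Tendsto (fun m : ℕ => (m : ℝ) * (paretoLaplace s (c m * x) - 1)) atTop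
      (𝓝 (-t * x ^ s)) := by
    have h3 : Tendsto (fun m => -(t / stableConst s * x ^ s) * I (c m * x)) atTop
        (𝓝 (-(t / stableConst s * x ^ s) * stableConst s)) := hIlim.const_mul _
    have h4 : -(t / stableConst s * x ^ s) * stableConst s = -t * x ^ s := by
      field_simp
    rw [h4] at h3
    refine h3.congr' ?_
    filter_upwards [eventually_gt_atTop 0] with m hm
    have hm' : (0 : ℝ) < m := by exact_mod_cast hm
    have hcm : 0 < c m := by positivity
    have h5 := one_sub_paretoLaplace hs (mul_pos hcm hx)
    have h6 : c m ^ s = t / (stableConst s * m) := by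
      rw [hc]; simp only
      rw [← Real.rpow_mul (by positivity), inv_mul_cancel₀ hs.ne', Real.rpow_one]
    rw [show paretoLaplace s (c m * x) - 1 = -(1 - paretoLaplace s (c m * x)) by ring, h5,
      Real.mul_rpow hcm.le hx.le, h6]
    change _ = (m : ℝ) * -(t / (stableConst s * m) * x ^ s * I (c m * x))
    generalize I (c m * x) = J
    field_simp
  refine (Real.tendsto_one_add_pow_exp_of_tendsto key).congr fun m => ?_
  rw [add_sub_cancel]

/-! ### Nonnegative, radially nonincreasing cosine transforms -/

/-- A function on `E` is radially unimodal if it is nonnegative and radially nonincreasing: it does not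
increase when the norm of its argument grows. -/
def IsRadiallyUnimodal {E : Type*} [NormedAddCommGroup E] (f : E → ℝ) : Prop :=
  ∀ z w : E, ‖z‖ ≤ ‖w‖ → 0 ≤ f w ∧ f w ≤ f z

theorem IsRadiallyUnimodal.of_tendsto {E ι : Type*} [NormedAddCommGroup E] {l : Filter ι}
    [l.NeBot] {f : ι → E → ℝ} {g : E → ℝ} (hf : ∀ᶠ i in l, IsRadiallyUnimodal (f i))
    (h : ∀ z, Tendsto (fun i => f i z) l (𝓝 (g z))) : IsRadiallyUnimodal g := fun z w hzw =>
  ⟨ge_of_tendsto (h w) (hf.mono fun _ hi => (hi z w hzw).1),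
    le_of_tendsto_of_tendsto (h w) (h z) (hf.mono fun _ hi => (hi z w hzw).2)⟩

section Unimodal

variable {E : Type*} [NormedAddCommGroup E] [InnerProductSpace ℝ E] [FiniteDimensional ℝ E]
  [MeasurableSpace E] [BorelSpace E]

/-- The cosine transform `z ↦ ∫ cos⟨ξ, z⟩ F(ξ) dξ`. -/
noncomputable def cosTransform (F : E → ℝ) (z : E) : ℝ :=
  ∫ ξ : E, Real.cos (inner ℝ ξ z) * F ξ

/-- The multipliers `F` for which every Gaussian regularization `e^{-δ|ξ|²} F(ξ)` has a unimodal
cosine transform. -/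
def IsUnimodalMultiplier (F : E → ℝ) : Prop :=
  ∀ δ : ℝ, 0 < δ → IsRadiallyUnimodal
    (cosTransform fun ξ : E => Real.exp (-δ * ‖ξ‖ ^ 2) * F ξ)

theorem integrable_cos_inner_mul {F : E → ℝ} (hF : Integrable F) (z : E) :
    Integrable fun ξ : E => Real.cos (inner ℝ ξ z) * F ξ := by
  refine hF.bdd_mul (c := 1) (by fun_prop) (Eventually.of_forall fun ξ => ?_)
  simpa using Real.abs_cos_le_one _

theorem tendsto_cosTransform {ι : Type*} {l : Filter ι} [l.IsCountablyGenerated]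
    {F : ι → E → ℝ} {G bound : E → ℝ} (hF : ∀ᶠ i in l, AEStronglyMeasurable (F i) volume)
    (hb : ∀ᶠ i in l, ∀ ξ, |F i ξ| ≤ bound ξ) (hbound : Integrable bound)
    (h : ∀ᵐ ξ, Tendsto (fun i => F i ξ) l (𝓝 (G ξ))) (z : E) :
    Tendsto (fun i => cosTransform (F i) z) l (𝓝 (cosTransform G z)) := by
  refine tendsto_integral_filter_of_dominated_convergence bound ?_ ?_ hbound ?_
  · filter_upwards [hF] with i hi
    exact AEStronglyMeasurable.mul (by fun_prop) hi
  · filter_upwards [hb] with i hi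
    refine Eventually.of_forall fun ξ => ?_
    rw [norm_mul, Real.norm_eq_abs, Real.norm_eq_abs]
    exact (mul_le_of_le_one_left (abs_nonneg _) (Real.abs_cos_le_one _)).trans (hi ξ)
  · filter_upwards [h] with ξ hξ using hξ.const_mul _

theorem isUnimodalMultiplier_one : IsUnimodalMultiplier (fun _ : E => (1 : ℝ)) := by
  intro δ hδ z w hzw
  simp only [cosTransform, mul_one]
  rw [integral_cos_inner_mul_gaussian hδ, integral_cos_inner_mul_gaussian hδ]
  refine ⟨by positivity, ?_⟩
  gcongr

/-- Multiplication by a Laplace transform in `|ξ|²` averages Gaussian regularizations, hence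
preserves unimodality. -/
theorem IsUnimodalMultiplier.mul_paretoLaplace {F : E → ℝ} (hF : IsUnimodalMultiplier F)
    (hm : Measurable F) (h0 : ∀ ξ, 0 ≤ F ξ) (h1 : ∀ ξ, F ξ ≤ 1) {s c : ℝ} (hs : 0 < s)
    (hc : 0 ≤ c) : IsUnimodalMultiplier (fun ξ => F ξ * paretoLaplace s (c * ‖ξ‖ ^ 2)) := by
  intro δ hδ
  have key : ∀ z, cosTransform
      (fun ξ : E => Real.exp (-δ * ‖ξ‖ ^ 2) * (F ξ * paretoLaplace s (c * ‖ξ‖ ^ 2))) z =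
      ∫ u in Set.Ioi (1 : ℝ), s * u ^ (-1 - s) *
        cosTransform (fun ξ : E => Real.exp (-(δ + c * u) * ‖ξ‖ ^ 2) * F ξ) z := by
    intro z
    have hint : Integrable (Function.uncurry fun (ξ : E) (u : ℝ) =>
        Real.cos (inner ℝ ξ z) * (Real.exp (-(δ + c * u) * ‖ξ‖ ^ 2) * F ξ) *
          (s * u ^ (-1 - s))) (volume.prod (volume.restrict (Set.Ioi (1 : ℝ)))) := by
      refine Integrable.mono'
        ((integrable_exp_neg_mul_norm_sq hδ).mul_prod (integrableOn_pareto hs)) ?_ ?_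
      · apply Measurable.aestronglyMeasurable
        unfold Function.uncurry
        fun_prop
      · have hae : ∀ᵐ p : E × ℝ ∂(volume.prod (volume.restrict (Set.Ioi (1 : ℝ)))),
            p.2 ∈ Set.Ioi (1 : ℝ) :=
          Measure.quasiMeasurePreserving_snd.ae (ae_restrict_mem measurableSet_Ioi)
        filter_upwards [hae] with p hp
        have hu0 : (0 : ℝ) < p.2 := zero_lt_one.trans hp
        have h4 : 0 ≤ s * p.2 ^ (-1 - s) := by positivity
        simp only [Function.uncurry]
        rw [norm_mul, norm_mul, norm_mul, Real.norm_of_nonneg h4,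
          Real.norm_of_nonneg (h0 _), Real.norm_of_nonneg (Real.exp_nonneg _)]
        have e1 : ‖Real.cos (inner ℝ p.1 z)‖ ≤ 1 := Real.abs_cos_le_one _
        have e2 : Real.exp (-(δ + c * p.2) * ‖p.1‖ ^ 2) ≤ Real.exp (-δ * ‖p.1‖ ^ 2) := by
          apply Real.exp_le_exp.2
          have : 0 ≤ c * p.2 * ‖p.1‖ ^ 2 := by positivity
          nlinarith
        calc _ ≤ 1 * (Real.exp (-δ * ‖p.1‖ ^ 2) * 1) * (s * p.2 ^ (-1 - s)) := by
              gcongr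
              · exact mul_nonneg (Real.exp_nonneg _) (h0 _)
              · exact h0 _
              · exact h1 _
          _ = _ := by ring
    have hswap := integral_integral_swap hint
    have hL : cosTransform
        (fun ξ : E => Real.exp (-δ * ‖ξ‖ ^ 2) * (F ξ * paretoLaplace s (c * ‖ξ‖ ^ 2))) z =
        ∫ ξ : E, ∫ u in Set.Ioi (1 : ℝ), Real.cos (inner ℝ ξ z) *
          (Real.exp (-(δ + c * u) * ‖ξ‖ ^ 2) * F ξ) * (s * u ^ (-1 - s)) := by
      refine integral_congr_ae (Eventually.of_forall fun ξ => ?_)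
      simp only [paretoLaplace]
      rw [← mul_assoc, ← mul_assoc, ← integral_const_mul]
      refine integral_congr_ae (Eventually.of_forall fun u => ?_)
      simp only
      rw [show -(δ + c * u) * ‖ξ‖ ^ 2 = -δ * ‖ξ‖ ^ 2 + -(c * ‖ξ‖ ^ 2 * u) by ring, Real.exp_add]
      ring
    rw [hL, hswap]
    refine integral_congr_ae (Eventually.of_forall fun u => ?_)
    simp only [cosTransform]
    rw [← integral_const_mul]
    refine integral_congr_ae (Eventually.of_forall fun ξ => ?_)
    simp only
    ring
  have hpos : ∀ u ∈ Set.Ioi (1 : ℝ), 0 < δ + c * u := by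
    intro u hu
    have hu0 : (0 : ℝ) < u := zero_lt_one.trans hu
    positivity
  have hint2 : ∀ z, IntegrableOn (fun u : ℝ => s * u ^ (-1 - s) *
        cosTransform (fun ξ : E => Real.exp (-(δ + c * u) * ‖ξ‖ ^ 2) * F ξ) z) (Set.Ioi 1) := by
    intro z
    have hmeas : Measurable fun u : ℝ =>
        cosTransform (fun ξ : E => Real.exp (-(δ + c * u) * ‖ξ‖ ^ 2) * F ξ) z := by
      have h : StronglyMeasurable (Function.uncurry fun (u : ℝ) (ξ : E) =>
          Real.cos (inner ℝ ξ z) * (Real.exp (-(δ + c * u) * ‖ξ‖ ^ 2) * F ξ)) := by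
        apply Measurable.stronglyMeasurable
        unfold Function.uncurry
        fun_prop
      exact (h.integral_prod_right (ν := (volume : Measure E))).measurable
    refine (integrableOn_pareto hs).mul_bdd (c := ∫ ξ : E, Real.exp (-δ * ‖ξ‖ ^ 2))
      hmeas.aestronglyMeasurable ?_
    filter_upwards [ae_restrict_mem measurableSet_Ioi] with u hu
    refine norm_integral_le_of_norm_le (integrable_exp_neg_mul_norm_sq hδ)
      (Eventually.of_forall fun ξ => ?_)
    have hu0 : (0 : ℝ) < u := zero_lt_one.trans hu
    rw [norm_mul, norm_mul, Real.norm_of_nonneg (h0 _), Real.norm_of_nonneg (Real.exp_nonneg _)]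
    have e1 : ‖Real.cos (inner ℝ ξ z)‖ ≤ 1 := Real.abs_cos_le_one _
    have e2 : Real.exp (-(δ + c * u) * ‖ξ‖ ^ 2) ≤ Real.exp (-δ * ‖ξ‖ ^ 2) := by
      apply Real.exp_le_exp.2
      have : 0 ≤ c * u * ‖ξ‖ ^ 2 := by positivity
      nlinarith
    calc _ ≤ 1 * (Real.exp (-δ * ‖ξ‖ ^ 2) * 1) := by
          gcongr
          · exact mul_nonneg (Real.exp_nonneg _) (h0 _)
          · exact h0 _
          · exact h1 _
      _ = _ := by ring
  intro z w hzw
  rw [key, key]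
  constructor
  · refine setIntegral_nonneg measurableSet_Ioi fun u hu => ?_
    have hu0 : (0 : ℝ) < u := zero_lt_one.trans hu
    have := (hF _ (hpos u hu) z w hzw).1
    positivity
  · refine setIntegral_mono_on (hint2 w) (hint2 z) measurableSet_Ioi fun u hu => ?_
    have hu0 : (0 : ℝ) < u := zero_lt_one.trans hu
    have := (hF _ (hpos u hu) z w hzw).2
    gcongr

theorem isUnimodalMultiplier_paretoLaplace_pow {s c : ℝ} (hs : 0 < s) (hc : 0 ≤ c) (m : ℕ) :
    IsUnimodalMultiplier (fun ξ : E => paretoLaplace s (c * ‖ξ‖ ^ 2) ^ m) := by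
  induction m with
  | zero => simpa using isUnimodalMultiplier_one
  | succ m ih =>
    simp only [pow_succ]
    refine ih.mul_paretoLaplace ?_ (fun ξ => ?_) (fun ξ => ?_) hs hc
    · exact ((measurable_paretoLaplace s).comp (by fun_prop)).pow_const m
    · exact pow_nonneg (paretoLaplace_nonneg hs _) m
    · exact pow_le_one₀ (paretoLaplace_nonneg hs _) (paretoLaplace_le_one hs (by positivity))

/-- The stable limit theorem transfers unimodality from powers of the Pareto Laplace transform to
`e^{-t|ξ|^{2s}}`; the Gaussian factor dominates all the integrands. -/
theorem isUnimodalMultiplier_exp_neg_mul_norm_rpow [Nontrivial E] {s t : ℝ} (hs : 0 < s)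
    (hs1 : s < 1) (ht : 0 < t) :
    IsUnimodalMultiplier (fun ξ : E => Real.exp (-t * ‖ξ‖ ^ (2 * s))) := by
  intro δ hδ
  have hκ := stableConst_pos hs hs1
  refine IsRadiallyUnimodal.of_tendsto (l := (atTop : Filter ℕ)) (Eventually.of_forall fun m =>
    isUnimodalMultiplier_paretoLaplace_pow (E := E) hs
      (c := (t / (stableConst s * m)) ^ s⁻¹) (by positivity) m δ hδ) fun z => ?_
  refine tendsto_cosTransform (bound := fun ξ : E => Real.exp (-δ * ‖ξ‖ ^ 2))
    (Eventually.of_forall fun m => ?_) (Eventually.of_forall fun m ξ => ?_)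
    (integrable_exp_neg_mul_norm_sq hδ) ?_ z
  · refine Measurable.aestronglyMeasurable (Measurable.mul (by fun_prop) ?_)
    exact ((measurable_paretoLaplace s).comp (by fun_prop)).pow_const m
  · have h0 := pow_nonneg (paretoLaplace_nonneg hs ((t / (stableConst s * m)) ^ s⁻¹ * ‖ξ‖ ^ 2)) m
    have h1 := pow_le_one₀ (n := m) (paretoLaplace_nonneg hs _)
      (paretoLaplace_le_one (x := (t / (stableConst s * m)) ^ s⁻¹ * ‖ξ‖ ^ 2) hs (by positivity))
    rw [abs_of_nonneg (by positivity)]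
    exact mul_le_of_le_one_right (Real.exp_nonneg _) h1
  · filter_upwards [Measure.ae_ne volume (0 : E)] with ξ hξ
    have hξ' : 0 < ‖ξ‖ := norm_pos_iff.2 hξ
    have := tendsto_paretoLaplace_pow (x := ‖ξ‖ ^ 2) hs hs1 ht (by positivity)
    rw [← Real.rpow_two, ← Real.rpow_mul hξ'.le] at this
    simp only [Real.rpow_two] at this
    exact this.const_mul _

/-- The cosine transform of `e^{-t|ξ|^{2s}}`, `0 < s < 1`, is nonnegative and radially
nonincreasing. -/
theorem isRadiallyUnimodal_cosTransform_exp_neg [Nontrivial E] {s t : ℝ} (hs : 0 < s)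
    (hs1 : s < 1) (ht : 0 < t) :
    IsRadiallyUnimodal (cosTransform fun ξ : E => Real.exp (-t * ‖ξ‖ ^ (2 * s))) := by
  refine IsRadiallyUnimodal.of_tendsto (l := 𝓝[>] (0 : ℝ))
    (f := fun δ => cosTransform
      (fun ξ : E => Real.exp (-δ * ‖ξ‖ ^ 2) * Real.exp (-t * ‖ξ‖ ^ (2 * s)))) ?_ fun z => ?_
  · filter_upwards [self_mem_nhdsWithin] with δ hδ
    exact isUnimodalMultiplier_exp_neg_mul_norm_rpow hs hs1 ht δ hδ
  refine tendsto_cosTransform (Eventually.of_forall fun δ => by fun_prop) ?_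
    (integrable_exp_neg_mul_norm_rpow ht (by positivity : 0 < 2 * s))
    (Eventually.of_forall fun ξ => ?_) z
  · filter_upwards [self_mem_nhdsWithin] with δ hδ ξ
    have hδ : (0 : ℝ) < δ := hδ
    rw [abs_of_nonneg (by positivity)]
    refine mul_le_of_le_one_left (Real.exp_nonneg _) (Real.exp_le_one_iff.2 ?_)
    have : 0 ≤ δ * ‖ξ‖ ^ 2 := by positivity
    linarith
  · have h : Continuous fun δ : ℝ => Real.exp (-δ * ‖ξ‖ ^ 2) * Real.exp (-t * ‖ξ‖ ^ (2 * s)) := by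
      fun_prop
    simpa using (h.tendsto 0).mono_left nhdsWithin_le_nhds

end Unimodal

/-! ### Testing cosine transforms against Gaussians -/

section GaussianTest

variable {E : Type*} [NormedAddCommGroup E] [InnerProductSpace ℝ E] [FiniteDimensional ℝ E]
  [MeasurableSpace E] [BorelSpace E]

theorem continuous_cosTransform {F : E → ℝ} (hF : Integrable F) : Continuous (cosTransform F) := by
  refine continuous_of_dominated (bound := fun ξ => |F ξ|) (fun z => ?_) (fun z => ?_) hF.abs ?_
  · exact (integrable_cos_inner_mul hF z).aestronglyMeasurable
  · refine Eventually.of_forall fun ξ => ?_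
    rw [norm_mul, Real.norm_eq_abs, Real.norm_eq_abs]
    exact mul_le_of_le_one_left (abs_nonneg _) (Real.abs_cos_le_one _)
  · exact Eventually.of_forall fun ξ => by fun_prop

/-- Testing a cosine transform against a Gaussian: Fubini, followed by the substitution
`ξ = 2 r η`. -/
theorem integral_cosTransform_mul_gaussian {F : E → ℝ} (hF : Integrable F) {r : ℝ} (hr : 0 < r) :
    ∫ z, cosTransform F z * Real.exp (-r ^ 2 * ‖z‖ ^ 2) =
      2 ^ Module.finrank ℝ E * Real.pi ^ ((Module.finrank ℝ E : ℝ) / 2) *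
        ∫ η, F ((2 * r) • η) * Real.exp (-‖η‖ ^ 2) := by
  have hr2 : 0 < r ^ 2 := by positivity
  have hint : Integrable (Function.uncurry fun (z ξ : E) =>
      (Real.cos (inner ℝ ξ z) * F ξ) * Real.exp (-r ^ 2 * ‖z‖ ^ 2)) (volume.prod volume) := by
    have h1 : Integrable (fun p : E × E => Real.exp (-r ^ 2 * ‖p.1‖ ^ 2) * F p.2)
      (volume.prod volume) := (integrable_exp_neg_mul_norm_sq hr2).mul_prod hF
    refine (h1.bdd_mul (c := 1) (f := fun p : E × E => Real.cos (inner ℝ p.2 p.1))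
      (by fun_prop) (Eventually.of_forall fun p => Real.abs_cos_le_one _)).congr
      (Eventually.of_forall fun p => ?_)
    simp only [Function.uncurry]
    ring
  have hL : ∫ z, cosTransform F z * Real.exp (-r ^ 2 * ‖z‖ ^ 2) =
      ∫ z, ∫ ξ, (Real.cos (inner ℝ ξ z) * F ξ) * Real.exp (-r ^ 2 * ‖z‖ ^ 2) := by
    refine integral_congr_ae (Eventually.of_forall fun z => ?_)
    simp only [cosTransform]
    rw [integral_mul_const]
  have hin : ∀ ξ : E, ∫ z, (Real.cos (inner ℝ ξ z) * F ξ) * Real.exp (-r ^ 2 * ‖z‖ ^ 2) =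
      (Real.pi / r ^ 2) ^ ((Module.finrank ℝ E : ℝ) / 2) *
        (F ξ * Real.exp (-‖ξ‖ ^ 2 / (4 * r ^ 2))) := by
    intro ξ
    have h := integral_cos_inner_mul_gaussian hr2 ξ
    calc _ = ∫ z, F ξ * (Real.cos (inner ℝ z ξ) * Real.exp (-r ^ 2 * ‖z‖ ^ 2)) := by
          refine integral_congr_ae (Eventually.of_forall fun z => ?_)
          simp only [real_inner_comm z ξ]
          ring
      _ = _ := by rw [integral_const_mul, h]; ring
  rw [hL, integral_integral_swap hint]
  simp only [hin]
  rw [integral_const_mul]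
  have h2r : 0 < 2 * r := by positivity
  have hsub := Measure.integral_comp_smul (volume : Measure E)
    (fun ξ : E => F ξ * Real.exp (-‖ξ‖ ^ 2 / (4 * r ^ 2))) (2 * r)
  have hexp : ∀ η : E, Real.exp (-‖(2 * r) • η‖ ^ 2 / (4 * r ^ 2)) = Real.exp (-‖η‖ ^ 2) := by
    intro η
    congr 1
    rw [norm_smul, Real.norm_of_nonneg h2r.le]
    field_simp
    ring
  simp only [hexp] at hsub
  rw [hsub, abs_of_nonneg (by positivity), smul_eq_mul]
  have hpow : (Real.pi / r ^ 2) ^ ((Module.finrank ℝ E : ℝ) / 2) =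
      Real.pi ^ ((Module.finrank ℝ E : ℝ) / 2) / r ^ Module.finrank ℝ E := by
    rw [Real.div_rpow Real.pi_pos.le hr2.le, ← Real.rpow_two, ← Real.rpow_mul hr.le,
      ← Real.rpow_natCast]
    congr 2
    ring
  rw [hpow, mul_pow]
  field_simp

/-- A nonnegative cosine transform of an integrable, bounded, continuous function `F` is integrable,
with integral `(2π)^d F(0)`. -/
theorem integrable_cosTransform_and_integral {F : E → ℝ} (hF : Integrable F) (hc : Continuous F)
    (hb : ∀ ξ, |F ξ| ≤ 1) (h0 : ∀ z, 0 ≤ cosTransform F z) :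
    Integrable (cosTransform F) ∧
      ∫ z, cosTransform F z = (2 * Real.pi) ^ Module.finrank ℝ E * F 0 := by
  have hcont := continuous_cosTransform hF
  set r : ℕ → ℝ := fun k => 1 / ((k : ℝ) + 1) with hrdef
  have hr : ∀ k, 0 < r k := fun k => by positivity
  have hr0 : Tendsto r atTop (𝓝 0) := tendsto_one_div_add_atTop_nhds_zero_nat
  have hlim : Tendsto (fun k => ∫ z, cosTransform F z * Real.exp (-(r k) ^ 2 * ‖z‖ ^ 2)) atTop
      (𝓝 ((2 * Real.pi) ^ Module.finrank ℝ E * F 0)) := by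
    simp only [fun k => integral_cosTransform_mul_gaussian hF (hr k)]
    have h1 : Tendsto (fun k => ∫ η : E, F ((2 * r k) • η) * Real.exp (-‖η‖ ^ 2)) atTop
        (𝓝 (∫ η : E, F 0 * Real.exp (-‖η‖ ^ 2))) := by
      refine tendsto_integral_of_dominated_convergence
        (fun η => Real.exp (-1 * ‖η‖ ^ 2)) (fun k => ?_)
        (integrable_exp_neg_mul_norm_sq one_pos) (fun k => ?_) ?_
      · exact Continuous.aestronglyMeasurable (by fun_prop)
      · refine Eventually.of_forall fun η => ?_
        rw [norm_mul, Real.norm_of_nonneg (Real.exp_nonneg _), neg_one_mul]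
        exact mul_le_of_le_one_left (Real.exp_nonneg _) (hb _)
      · refine Eventually.of_forall fun η => Tendsto.mul_const _ ?_
        have h2 : Tendsto (fun k => (2 * r k) • η) atTop (𝓝 ((2 * (0 : ℝ)) • η)) :=
          (hr0.const_mul 2).smul_const η
        rw [mul_zero, zero_smul] at h2
        exact (hc.tendsto 0).comp h2
    have h2 : ∫ η : E, Real.exp (-‖η‖ ^ 2) = Real.pi ^ ((Module.finrank ℝ E : ℝ) / 2) := by
      simpa using integral_exp_neg_mul_norm_sq (E := E) one_pos
    rw [integral_const_mul, h2] at h1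
    have h3 := h1.const_mul (2 ^ Module.finrank ℝ E * Real.pi ^ ((Module.finrank ℝ E : ℝ) / 2))
    have hpi : Real.pi ^ ((Module.finrank ℝ E : ℝ) / 2) * Real.pi ^ ((Module.finrank ℝ E : ℝ) / 2) =
        Real.pi ^ Module.finrank ℝ E := by
      rw [← Real.rpow_add Real.pi_pos, add_halves, Real.rpow_natCast]
    convert h3 using 2
    rw [mul_pow, ← hpi]
    ring
  have hgint : ∀ k, Integrable fun z => cosTransform F z * Real.exp (-(r k) ^ 2 * ‖z‖ ^ 2) := by
    intro k
    refine (integrable_exp_neg_mul_norm_sq (by have := hr k; positivity)).bdd_mul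
      (c := ∫ ξ, |F ξ|) hcont.aestronglyMeasurable (Eventually.of_forall fun z => ?_)
    refine norm_integral_le_of_norm_le hF.abs (Eventually.of_forall fun ξ => ?_)
    rw [norm_mul, Real.norm_eq_abs, Real.norm_eq_abs]
    exact mul_le_of_le_one_left (abs_nonneg _) (Real.abs_cos_le_one _)
  have hpt : ∀ z, Tendsto (fun k => cosTransform F z * Real.exp (-(r k) ^ 2 * ‖z‖ ^ 2)) atTop
      (𝓝 (cosTransform F z)) := by
    intro z
    have h : Continuous fun x : ℝ => cosTransform F z * Real.exp (-x ^ 2 * ‖z‖ ^ 2) := by fun_prop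
    simpa [Function.comp_def] using (h.tendsto 0).comp hr0
  have hint : Integrable (cosTransform F) := by
    refine ⟨hcont.aestronglyMeasurable, ?_⟩
    have hfatou : ∫⁻ z, ENNReal.ofReal (cosTransform F z) ≤
        liminf (fun k => ∫⁻ z, ENNReal.ofReal
          (cosTransform F z * Real.exp (-(r k) ^ 2 * ‖z‖ ^ 2))) atTop := by
      refine le_trans (le_of_eq ?_) (lintegral_liminf_le fun k => by fun_prop)
      refine lintegral_congr fun z => ?_
      exact (ENNReal.tendsto_ofReal (hpt z)).liminf_eq.symm
    have hval : ∀ k, ∫⁻ z, ENNReal.ofReal (cosTransform F z * Real.exp (-(r k) ^ 2 * ‖z‖ ^ 2)) =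
        ENNReal.ofReal (∫ z, cosTransform F z * Real.exp (-(r k) ^ 2 * ‖z‖ ^ 2)) := fun k =>
      (ofReal_integral_eq_lintegral_ofReal (hgint k) (Eventually.of_forall fun z =>
        mul_nonneg (h0 z) (Real.exp_nonneg _))).symm
    simp only [hval] at hfatou
    rw [(ENNReal.tendsto_ofReal hlim).liminf_eq] at hfatou
    rw [hasFiniteIntegral_iff_ofReal (Eventually.of_forall h0)]
    exact hfatou.trans_lt ENNReal.ofReal_lt_top
  refine ⟨hint, tendsto_nhds_unique ?_ hlim⟩
  refine tendsto_integral_of_dominated_convergence (cosTransform F)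
    (fun k => (hgint k).aestronglyMeasurable) hint (fun k => ?_) (Eventually.of_forall hpt)
  refine Eventually.of_forall fun z => ?_
  rw [Real.norm_of_nonneg (mul_nonneg (h0 z) (Real.exp_nonneg _))]
  refine mul_le_of_le_one_right (h0 z) (Real.exp_le_one_iff.2 ?_)
  have : 0 ≤ (r k) ^ 2 * ‖z‖ ^ 2 := by positivity
  linarith

end GaussianTest

/-! ### The fractional heat kernel: total mass, scaling, upper bound -/

section Kernel

variable {n : ℕ} [NeZero n] {s : ℝ}

theorem fracHeatKernel_eq_cosTransform (n : ℕ) (s : ℝ) (z : EuclideanSpace ℝ (Fin n)) (t : ℝ) :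
    fracHeatKernel n s z t =
      ((2 * Real.pi) ^ n)⁻¹ * cosTransform (fun ξ => Real.exp (-t * ‖ξ‖ ^ (2 * s))) z := rfl

theorem fracHeatKernel_nonneg (hs : 0 < s) (hs1 : s < 1) {t : ℝ} (ht : 0 < t)
    (z : EuclideanSpace ℝ (Fin n)) : 0 ≤ fracHeatKernel n s z t := by
  have := (isRadiallyUnimodal_cosTransform_exp_neg hs hs1 ht z z le_rfl).1
  rw [fracHeatKernel_eq_cosTransform]
  positivity

theorem fracHeatKernel_le_of_norm_le (hs : 0 < s) (hs1 : s < 1) {t : ℝ} (ht : 0 < t)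
    {z w : EuclideanSpace ℝ (Fin n)} (h : ‖z‖ ≤ ‖w‖) :
    fracHeatKernel n s w t ≤ fracHeatKernel n s z t := by
  have := (isRadiallyUnimodal_cosTransform_exp_neg hs hs1 ht z w h).2
  rw [fracHeatKernel_eq_cosTransform, fracHeatKernel_eq_cosTransform]
  gcongr

theorem continuous_fracHeatKernel (hs : 0 < s) {t : ℝ} (ht : 0 < t) :
    Continuous fun z : EuclideanSpace ℝ (Fin n) => fracHeatKernel n s z t :=
  (continuous_cosTransform
    (integrable_exp_neg_mul_norm_rpow ht (by positivity : 0 < 2 * s))).const_mul _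

theorem exp_neg_mul_norm_rpow_le_one {E : Type*} [NormedAddCommGroup E] {t p : ℝ} (ht : 0 ≤ t)
    (ξ : E) : Real.exp (-t * ‖ξ‖ ^ p) ≤ 1 := by
  refine Real.exp_le_one_iff.2 ?_
  have : 0 ≤ t * ‖ξ‖ ^ p := by positivity
  linarith

theorem integrable_fracHeatKernel_and_integral (hs : 0 < s) (hs1 : s < 1) {t : ℝ} (ht : 0 < t) :
    Integrable (fun z : EuclideanSpace ℝ (Fin n) => fracHeatKernel n s z t) ∧
      ∫ z : EuclideanSpace ℝ (Fin n), fracHeatKernel n s z t = 1 := by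
  have hp : 0 < 2 * s := by positivity
  have h := integrable_cosTransform_and_integral
    (F := fun ξ : EuclideanSpace ℝ (Fin n) => Real.exp (-t * ‖ξ‖ ^ (2 * s)))
    (integrable_exp_neg_mul_norm_rpow ht hp)
    (Real.continuous_exp.comp ((continuous_norm.rpow_const fun _ => Or.inr hp.le).const_mul _))
    (fun ξ => by
      rw [abs_of_nonneg (Real.exp_nonneg _)]
      exact exp_neg_mul_norm_rpow_le_one ht.le ξ)
    (fun z => (isRadiallyUnimodal_cosTransform_exp_neg hs hs1 ht z z le_rfl).1)
  refine ⟨h.1.const_mul _, ?_⟩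
  simp only [fracHeatKernel_eq_cosTransform]
  rw [integral_const_mul, h.2, norm_zero, Real.zero_rpow hp.ne', finrank_euclideanSpace_fin]
  have : (2 * Real.pi) ^ n ≠ 0 := by positivity
  simp [this]

/-- Self-similarity: `P^s(cz, c^{2s}t) = c^{-n} P^s(z,t)`. -/
theorem fracHeatKernel_smul {n : ℕ} {s c : ℝ} (hc : 0 < c) (t : ℝ) (z : EuclideanSpace ℝ (Fin n)) :
    fracHeatKernel n s (c • z) (c ^ (2 * s) * t) = (c ^ n)⁻¹ * fracHeatKernel n s z t := by
  have h := Measure.integral_comp_smul (volume : Measure (EuclideanSpace ℝ (Fin n)))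
    (fun η => Real.cos (inner ℝ η z) * Real.exp (-t * ‖η‖ ^ (2 * s))) c
  rw [abs_of_nonneg (by positivity), finrank_euclideanSpace_fin, smul_eq_mul] at h
  rw [fracHeatKernel, fracHeatKernel, mul_left_comm, ← h]
  congr 1
  refine integral_congr_ae (Eventually.of_forall fun ξ => ?_)
  simp only
  rw [real_inner_smul_left, real_inner_smul_right, norm_smul, Real.norm_of_nonneg hc.le,
    Real.mul_rpow hc.le (norm_nonneg _)]
  ring_nf

/-- `∫ P^s(w,t) (1 - e^{-|w|²}) dw`, which measures the mass that has left the origin. -/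
theorem integral_fracHeatKernel_mul_one_sub_gaussian (hs : 0 < s) (hs1 : s < 1) {t : ℝ}
    (ht : 0 < t) :
    ∫ w : EuclideanSpace ℝ (Fin n), fracHeatKernel n s w t * (1 - Real.exp (-‖w‖ ^ 2)) =
      (Real.pi ^ ((n : ℝ) / 2))⁻¹ * ∫ η : EuclideanSpace ℝ (Fin n),
        (1 - Real.exp (-t * ‖(2 : ℝ) • η‖ ^ (2 * s))) * Real.exp (-‖η‖ ^ 2) := by
  have hp : 0 < 2 * s := by positivity
  obtain ⟨hi, h1⟩ := integrable_fracHeatKernel_and_integral (n := n) hs hs1 ht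
  have hg := integral_cosTransform_mul_gaussian
    (integrable_exp_neg_mul_norm_rpow (E := EuclideanSpace ℝ (Fin n)) ht hp) one_pos
  simp only [one_pow, neg_mul, one_mul, mul_one, finrank_euclideanSpace_fin] at hg
  have hi2 : Integrable fun w : EuclideanSpace ℝ (Fin n) =>
      fracHeatKernel n s w t * Real.exp (-‖w‖ ^ 2) := by
    refine hi.mul_bdd (c := 1) (by fun_prop) (Eventually.of_forall fun w => ?_)
    rw [Real.norm_of_nonneg (Real.exp_nonneg _)]
    exact Real.exp_le_one_iff.2 (by have : 0 ≤ ‖w‖ ^ 2 := by positivity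
                                    linarith)
  have hgi : Integrable fun w : EuclideanSpace ℝ (Fin n) => Real.exp (-‖w‖ ^ 2) := by
    simpa using integrable_exp_neg_mul_norm_sq (E := EuclideanSpace ℝ (Fin n)) one_pos
  have hgi2 : Integrable fun η : EuclideanSpace ℝ (Fin n) =>
      Real.exp (-t * ‖(2 : ℝ) • η‖ ^ (2 * s)) * Real.exp (-‖η‖ ^ 2) := by
    refine hgi.bdd_mul (c := 1) (Measurable.aestronglyMeasurable (by fun_prop))
      (Eventually.of_forall fun w => ?_)
    rw [Real.norm_of_nonneg (Real.exp_nonneg _)]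
    exact exp_neg_mul_norm_rpow_le_one ht.le _
  have hpi : ∫ w : EuclideanSpace ℝ (Fin n), Real.exp (-‖w‖ ^ 2) = Real.pi ^ ((n : ℝ) / 2) := by
    simpa using integral_exp_neg_mul_norm_sq (E := EuclideanSpace ℝ (Fin n)) one_pos
  have hpin : Real.pi ^ ((n : ℝ) / 2) * Real.pi ^ ((n : ℝ) / 2) = Real.pi ^ n := by
    rw [← Real.rpow_add Real.pi_pos, add_halves, Real.rpow_natCast]
  have hA : ∫ w : EuclideanSpace ℝ (Fin n), fracHeatKernel n s w t * Real.exp (-‖w‖ ^ 2) =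
      (Real.pi ^ ((n : ℝ) / 2))⁻¹ * ∫ η : EuclideanSpace ℝ (Fin n),
        Real.exp (-t * ‖(2 : ℝ) • η‖ ^ (2 * s)) * Real.exp (-‖η‖ ^ 2) := by
    simp only [fracHeatKernel_eq_cosTransform, mul_assoc, neg_mul]
    rw [integral_const_mul, hg, mul_pow, ← hpin]
    have : Real.pi ^ ((n : ℝ) / 2) ≠ 0 := by positivity
    field_simp
  simp only [mul_sub, mul_one, sub_mul, one_mul]
  rw [integral_sub hi hi2, h1, hA, integral_sub hgi hgi2, hpi, mul_sub, inv_mul_cancel₀]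
  positivity

theorem integrable_fracHeatKernel_mul_one_sub_gaussian (hs : 0 < s) (hs1 : s < 1) {t : ℝ}
    (ht : 0 < t) : Integrable fun w : EuclideanSpace ℝ (Fin n) =>
      fracHeatKernel n s w t * (1 - Real.exp (-‖w‖ ^ 2)) := by
  refine (integrable_fracHeatKernel_and_integral hs hs1 ht).1.mul_bdd (c := 1) (by fun_prop)
    (Eventually.of_forall fun w => ?_)
  have : Real.exp (-‖w‖ ^ 2) ≤ 1 := Real.exp_le_one_iff.2 (by
    have : 0 ≤ ‖w‖ ^ 2 := by positivity
    linarith)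
  have := Real.exp_pos (-‖w‖ ^ 2)
  rw [Real.norm_eq_abs, abs_le]
  constructor <;> linarith

theorem one_sub_exp_neg_norm_sq_nonneg {E : Type*} [NormedAddCommGroup E] (w : E) :
    0 ≤ 1 - Real.exp (-‖w‖ ^ 2) := by
  have : Real.exp (-‖w‖ ^ 2) ≤ 1 := Real.exp_le_one_iff.2 (by
    have : 0 ≤ ‖w‖ ^ 2 := by positivity
    linarith)
  linarith

theorem one_sub_exp_neg_norm_sq_pos {E : Type*} [NormedAddCommGroup E] {w : E} (hw : w ≠ 0) :
    0 < 1 - Real.exp (-‖w‖ ^ 2) := by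
  have : Real.exp (-‖w‖ ^ 2) < 1 := Real.exp_lt_one_iff.2 (by
    have : 0 < ‖w‖ := norm_pos_iff.2 hw
    have : 0 < ‖w‖ ^ 2 := by positivity
    linarith)
  linarith

/-- At most a multiple of `t` of the mass has left the origin, because `1 - e^{-x} ≤ x`. -/
theorem exists_integral_one_sub_gaussian_le (n : ℕ) [NeZero n] (hs : 0 < s) (hs1 : s < 1) :
    ∃ C : ℝ, 0 < C ∧ ∀ t : ℝ, 0 < t →
      ∫ w : EuclideanSpace ℝ (Fin n), fracHeatKernel n s w t * (1 - Real.exp (-‖w‖ ^ 2)) ≤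
        C * t := by
  have hp : 0 < 2 * s := by positivity
  have hI : Integrable fun η : EuclideanSpace ℝ (Fin n) =>
      ‖(2 : ℝ) • η‖ ^ (2 * s) * Real.exp (-‖η‖ ^ 2) := by
    have := (integrable_norm_rpow_mul_exp_neg (E := EuclideanSpace ℝ (Fin n)) (t := 1) (p := 2)
      (q := 2 * s) one_pos two_pos hp.le).const_mul ((2 : ℝ) ^ (2 * s))
    refine this.congr (Eventually.of_forall fun η => ?_)
    simp only [norm_smul, Real.norm_ofNat, neg_one_mul, Real.rpow_two]
    rw [Real.mul_rpow two_pos.le (norm_nonneg _), mul_assoc]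
  set C := (Real.pi ^ ((n : ℝ) / 2))⁻¹ * ∫ η : EuclideanSpace ℝ (Fin n),
      ‖(2 : ℝ) • η‖ ^ (2 * s) * Real.exp (-‖η‖ ^ 2) with hC
  have hC0 : 0 ≤ C := mul_nonneg (by positivity) (integral_nonneg fun η => by positivity)
  refine ⟨C + 1, by positivity, fun t ht => ?_⟩
  rw [integral_fracHeatKernel_mul_one_sub_gaussian hs hs1 ht]
  have : ∫ η : EuclideanSpace ℝ (Fin n),
        (1 - Real.exp (-t * ‖(2 : ℝ) • η‖ ^ (2 * s))) * Real.exp (-‖η‖ ^ 2) ≤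
      ∫ η : EuclideanSpace ℝ (Fin n), t * (‖(2 : ℝ) • η‖ ^ (2 * s) * Real.exp (-‖η‖ ^ 2)) := by
    refine integral_mono_of_nonneg (Eventually.of_forall fun η => ?_) (hI.const_mul t)
      (Eventually.of_forall fun η => ?_)
    · have := exp_neg_mul_norm_rpow_le_one (p := 2 * s) ht.le ((2 : ℝ) • η)
      exact mul_nonneg (by linarith) (Real.exp_nonneg _)
    · simp only
      rw [← mul_assoc]
      gcongr
      have := Real.add_one_le_exp (-t * ‖(2 : ℝ) • η‖ ^ (2 * s))
      linarith
  rw [integral_const_mul] at this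
  calc _ ≤ (Real.pi ^ ((n : ℝ) / 2))⁻¹ * (t * ∫ η : EuclideanSpace ℝ (Fin n),
          ‖(2 : ℝ) • η‖ ^ (2 * s) * Real.exp (-‖η‖ ^ 2)) := by gcongr
    _ = C * t := by rw [hC]; ring
    _ ≤ (C + 1) * t := by nlinarith

/-- At least a multiple of `t` of the mass has left the origin; the constant is the value at `t = 1`. -/
theorem exists_le_integral_one_sub_gaussian (n : ℕ) [NeZero n] (hs : 0 < s) (hs1 : s < 1) :
    ∃ c : ℝ, 0 < c ∧ ∀ t : ℝ, 0 < t → t ≤ 1 → c * t ≤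
      ∫ w : EuclideanSpace ℝ (Fin n), fracHeatKernel n s w t * (1 - Real.exp (-‖w‖ ^ 2)) := by
  have hp : 0 < 2 * s := by positivity
  have hgi : Integrable fun w : EuclideanSpace ℝ (Fin n) => Real.exp (-‖w‖ ^ 2) := by
    simpa using integrable_exp_neg_mul_norm_sq (E := EuclideanSpace ℝ (Fin n)) one_pos
  have hI : ∀ t : ℝ, 0 < t → Integrable fun η : EuclideanSpace ℝ (Fin n) =>
      (1 - Real.exp (-t * ‖(2 : ℝ) • η‖ ^ (2 * s))) * Real.exp (-‖η‖ ^ 2) := by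
    intro t ht
    refine hgi.bdd_mul (c := 1) (Measurable.aestronglyMeasurable (by fun_prop))
      (Eventually.of_forall fun η => ?_)
    have := exp_neg_mul_norm_rpow_le_one (p := 2 * s) ht.le ((2 : ℝ) • η)
    have := Real.exp_pos (-t * ‖(2 : ℝ) • η‖ ^ (2 * s))
    rw [Real.norm_eq_abs, abs_le]
    constructor <;> linarith
  refine ⟨(Real.pi ^ ((n : ℝ) / 2))⁻¹ * ∫ η : EuclideanSpace ℝ (Fin n),
    (1 - Real.exp (-1 * ‖(2 : ℝ) • η‖ ^ (2 * s))) * Real.exp (-‖η‖ ^ 2), ?_, ?_⟩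
  · refine mul_pos (by positivity) ?_
    rw [integral_pos_iff_support_of_nonneg _ (hI 1 one_pos)]
    · have hsub : ({0}ᶜ : Set (EuclideanSpace ℝ (Fin n))) ⊆ Function.support
          (fun η : EuclideanSpace ℝ (Fin n) =>
            (1 - Real.exp (-1 * ‖(2 : ℝ) • η‖ ^ (2 * s))) * Real.exp (-‖η‖ ^ 2)) := by
        intro η hη
        have hη' : 0 < ‖(2 : ℝ) • η‖ := norm_pos_iff.2 (smul_ne_zero two_ne_zero hη)
        have h1 : 0 < ‖(2 : ℝ) • η‖ ^ (2 * s) := by positivity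
        have h2 : Real.exp (-1 * ‖(2 : ℝ) • η‖ ^ (2 * s)) < 1 :=
          Real.exp_lt_one_iff.2 (by linarith)
        exact mul_ne_zero (by linarith) (Real.exp_pos _).ne'
      exact (isOpen_compl_singleton.measure_pos volume
        (Set.nonempty_compl_of_nontrivial _)).trans_le (measure_mono hsub)
    · intro η
      have := exp_neg_mul_norm_rpow_le_one (p := 2 * s) zero_le_one ((2 : ℝ) • η)
      exact mul_nonneg (by linarith) (Real.exp_nonneg _)
  · intro t ht ht1
    rw [integral_fracHeatKernel_mul_one_sub_gaussian hs hs1 ht, mul_assoc, mul_comm _ t,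
      ← integral_const_mul]
    refine mul_le_mul_of_nonneg_left ?_ (by positivity)
    refine integral_mono ((hI 1 one_pos).const_mul t) (hI t ht) fun η => ?_
    simp only
    rw [← mul_assoc]
    refine mul_le_mul_of_nonneg_right ?_ (Real.exp_nonneg _)
    -- concavity of `t ↦ 1 - e^{-ta}`, which vanishes at `0`
    have := convexOn_exp.2 (Set.mem_univ (-1 * ‖(2 : ℝ) • η‖ ^ (2 * s))) (Set.mem_univ 0)
      ht.le (sub_nonneg.2 ht1) (by ring)
    simp only [smul_eq_mul, mul_zero, add_zero, Real.exp_zero, mul_one] at this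
    rw [show t * (-1 * ‖(2 : ℝ) • η‖ ^ (2 * s)) = -t * ‖(2 : ℝ) • η‖ ^ (2 * s) by ring] at this
    linarith

/-- The upper bound `P^s(z,t) ≤ C t |z|^{-n-2s}`. On the unit sphere it follows from monotonicity and
`exists_integral_one_sub_gaussian_le`; scaling does the rest. -/
theorem exists_fracHeatKernel_le (n : ℕ) [NeZero n] (hs : 0 < s) (hs1 : s < 1) :
    ∃ C : ℝ, 0 < C ∧ ∀ t : ℝ, 0 < t → ∀ z : EuclideanSpace ℝ (Fin n), z ≠ 0 →
      fracHeatKernel n s z t ≤ C * t * (1 / ‖z‖ ^ ((n : ℝ) + 2 * s)) := by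
  obtain ⟨C, hC, hCt⟩ := exists_integral_one_sub_gaussian_le n hs hs1
  set B := Metric.ball (0 : EuclideanSpace ℝ (Fin n)) 1
  have hgB : IntegrableOn (fun w : EuclideanSpace ℝ (Fin n) => 1 - Real.exp (-‖w‖ ^ 2)) B :=
    ((by fun_prop : Continuous fun w : EuclideanSpace ℝ (Fin n) =>
      1 - Real.exp (-‖w‖ ^ 2)).continuousOn.integrableOn_compact
        (isCompact_closedBall 0 1)).mono_set Metric.ball_subset_closedBall
  set κ := ∫ w in B, (1 - Real.exp (-‖w‖ ^ 2)) with hκ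
  have hκ0 : 0 < κ := by
    rw [hκ, setIntegral_pos_iff_support_of_nonneg_ae
      (Eventually.of_forall fun w => one_sub_exp_neg_norm_sq_nonneg w) hgB]
    have hsub : B \ {0} ⊆ Function.support
        (fun w : EuclideanSpace ℝ (Fin n) => 1 - Real.exp (-‖w‖ ^ 2)) ∩ B :=
      fun w hw => ⟨(one_sub_exp_neg_norm_sq_pos hw.2).ne', hw.1⟩
    refine lt_of_lt_of_le ?_ (measure_mono hsub)
    rw [measure_sdiff_null (by simp)]
    exact Metric.measure_ball_pos _ _ one_pos
  -- on the unit sphere, compare with the mass of the unit ball by monotonicity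
  have hunit : ∀ t : ℝ, 0 < t → ∀ w : EuclideanSpace ℝ (Fin n), ‖w‖ = 1 →
      fracHeatKernel n s w t ≤ C / κ * t := by
    intro t ht w hw
    have hi := integrable_fracHeatKernel_mul_one_sub_gaussian (n := n) hs hs1 ht
    have h1 : fracHeatKernel n s w t * κ ≤
        ∫ y in B, fracHeatKernel n s y t * (1 - Real.exp (-‖y‖ ^ 2)) := by
      rw [hκ, ← integral_const_mul]
      refine setIntegral_mono_on (hgB.const_mul _) hi.integrableOn measurableSet_ball
        fun y hy => ?_
      refine mul_le_mul_of_nonneg_right (fracHeatKernel_le_of_norm_le hs hs1 ht ?_)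
        (one_sub_exp_neg_norm_sq_nonneg y)
      rw [hw]
      exact (mem_ball_zero_iff.1 hy).le
    have h2 : ∫ y in B, fracHeatKernel n s y t * (1 - Real.exp (-‖y‖ ^ 2)) ≤
        ∫ y, fracHeatKernel n s y t * (1 - Real.exp (-‖y‖ ^ 2)) :=
      setIntegral_le_integral hi (Eventually.of_forall fun y =>
        mul_nonneg (fracHeatKernel_nonneg hs hs1 ht y) (one_sub_exp_neg_norm_sq_nonneg y))
    rw [div_mul_eq_mul_div, le_div_iff₀ hκ0]
    exact h1.trans (h2.trans (hCt t ht))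
  refine ⟨C / κ, by positivity, fun t ht z hz => ?_⟩
  have hc : 0 < ‖z‖ := norm_pos_iff.2 hz
  have hscale := fracHeatKernel_smul (n := n) (s := s) hc (‖z‖ ^ (-(2 * s)) * t) (‖z‖⁻¹ • z)
  rw [smul_inv_smul₀ hc.ne', ← mul_assoc, ← Real.rpow_add hc, add_neg_cancel, Real.rpow_zero,
    one_mul] at hscale
  rw [hscale]
  have := hunit (‖z‖ ^ (-(2 * s)) * t) (by positivity) (‖z‖⁻¹ • z)
    (by rw [norm_smul, norm_inv, norm_norm, inv_mul_cancel₀ hc.ne'])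
  calc _ ≤ (‖z‖ ^ n)⁻¹ * (C / κ * (‖z‖ ^ (-(2 * s)) * t)) := by gcongr
    _ = _ := by
      rw [Real.rpow_add hc, Real.rpow_natCast, Real.rpow_neg hc.le]
      field_simp

end Kernel

/-! ### The lower bound for the heat kernel -/

section LowerBound

theorem integrable_one_sub_gaussian_div_rpow (n : ℕ) [NeZero n] {s : ℝ} (hs : 0 < s)
    (hs2 : s < 1 / 2) : Integrable fun w : EuclideanSpace ℝ (Fin n) =>
      (1 / ‖w‖ ^ ((n : ℝ) + 2 * s)) * (1 - Real.exp (-‖w‖ ^ 2)) := by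
  have hfr : (Module.finrank ℝ (EuclideanSpace ℝ (Fin n)) : ℝ) = n := by simp
  have := integrable_min_one_norm_div_rpow (E := EuclideanSpace ℝ (Fin n))
    (a := (n : ℝ) + 2 * s) (by rw [hfr]; linarith) (by rw [hfr]; linarith)
  refine this.mono' (Measurable.aestronglyMeasurable (by fun_prop))
    (Eventually.of_forall fun w => ?_)
  have h0 := one_sub_exp_neg_norm_sq_nonneg w
  rw [Real.norm_of_nonneg (by positivity), one_div_mul_eq_div]
  gcongr
  refine le_min (by linarith [Real.exp_pos (-‖w‖ ^ 2)]) ?_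
  rcases le_total ‖w‖ 1 with h | h
  · have := Real.add_one_le_exp (-‖w‖ ^ 2)
    nlinarith [norm_nonneg w]
  · linarith [Real.exp_pos (-‖w‖ ^ 2)]

/-- Since the heat kernel is at most `C t |w|^{-n-2s}`, a fixed proportion of the quantity
`∫ P^s(w,t) (1 - e^{-|w|²}) dw ≥ c t` lives on a fixed annulus; monotonicity then bounds the kernel
from below inside the annulus. -/
theorem exists_le_fracHeatKernel_of_norm_le (n : ℕ) [NeZero n] {s : ℝ} (hs : 0 < s)
    (hs2 : s < 1 / 2) : ∃ a c : ℝ, 0 < a ∧ 0 < c ∧ ∀ t : ℝ, 0 < t → t ≤ 1 →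
      ∀ z : EuclideanSpace ℝ (Fin n), ‖z‖ ≤ a → c * t ≤ fracHeatKernel n s z t := by
  have hs1 : s < 1 := by linarith
  obtain ⟨C, hC, hCt⟩ := exists_fracHeatKernel_le n hs hs1
  obtain ⟨c, hc, hct⟩ := exists_le_integral_one_sub_gaussian n hs hs1
  have hk := integrable_one_sub_gaussian_div_rpow n hs hs2
  set k : EuclideanSpace ℝ (Fin n) → ℝ := fun w =>
    (1 / ‖w‖ ^ ((n : ℝ) + 2 * s)) * (1 - Real.exp (-‖w‖ ^ 2)) with hkdef
  set A : ℕ → Set (EuclideanSpace ℝ (Fin n)) := fun m =>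
    {w | 1 / ((m : ℝ) + 1) < ‖w‖ ∧ ‖w‖ < (m : ℝ) + 1} with hA
  have hAm : ∀ m, MeasurableSet (A m) := fun m =>
    (measurableSet_lt measurable_const measurable_norm).inter
      (measurableSet_lt measurable_norm measurable_const)
  have hAmono : Antitone fun m => (A m)ᶜ := by
    intro m m' hmm
    refine Set.compl_subset_compl.2 fun w hw => ⟨lt_of_le_of_lt ?_ hw.1, hw.2.trans_le ?_⟩
    · exact one_div_le_one_div_of_le (by positivity) (by gcongr)
    · gcongr
  have hAinter : ⋂ m, (A m)ᶜ ⊆ {0} := by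
    intro w hw
    by_contra hw0
    have hw' : 0 < ‖w‖ := norm_pos_iff.2 hw0
    obtain ⟨m1, hm1⟩ := exists_nat_one_div_lt hw'
    obtain ⟨m2, hm2⟩ := exists_nat_gt ‖w‖
    refine Set.mem_iInter.1 hw (max m1 m2) ⟨lt_of_le_of_lt ?_ hm1, hm2.trans_le ?_⟩
    · exact one_div_le_one_div_of_le (by positivity) (by gcongr; exact le_max_left _ _)
    · have : (m2 : ℝ) ≤ (max m1 m2 : ℕ) := by exact_mod_cast le_max_right _ _
      linarith
  have hlim : Tendsto (fun m => ∫ w in (A m)ᶜ, k w) atTop (𝓝 0) := by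
    have h := tendsto_setIntegral_of_antitone (fun m => (hAm m).compl) hAmono
      ⟨0, hk.integrableOn⟩
    rwa [setIntegral_measure_zero _ (measure_mono_null hAinter (by simp))] at h
  obtain ⟨m, hm⟩ := ((hlim.const_mul C).eventually
    (gt_mem_nhds (by simpa using half_pos hc : C * 0 < c / 2))).exists
  set B := Metric.ball (0 : EuclideanSpace ℝ (Fin n)) ((m : ℝ) + 1)
  have hAB : A m ⊆ B := fun w hw => mem_ball_zero_iff.2 hw.2
  have hAfin : volume (A m) ≠ ⊤ := ((measure_mono hAB).trans_lt measure_ball_lt_top).ne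
  set v := volume.real (A m) with hv
  have hv0 : 0 ≤ v := measureReal_nonneg
  refine ⟨1 / ((m : ℝ) + 1), c / 2 / (v + 1), by positivity, by positivity,
    fun t ht ht1 z hz => ?_⟩
  have hi := integrable_fracHeatKernel_mul_one_sub_gaussian (n := n) hs hs1 ht
  have hsplit := integral_add_compl (hAm m) hi
  have h1 : ∫ w in A m, fracHeatKernel n s w t * (1 - Real.exp (-‖w‖ ^ 2)) ≤
      fracHeatKernel n s z t * v := by
    have : ∫ w in A m, fracHeatKernel n s z t = fracHeatKernel n s z t * v := by
      rw [setIntegral_const, smul_eq_mul, mul_comm]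
    rw [← this]
    refine setIntegral_mono_on hi.integrableOn (integrableOn_const hAfin) (hAm m) fun w hw => ?_
    have h2 := fracHeatKernel_le_of_norm_le hs hs1 ht (hz.trans hw.1.le)
    have h3 := fracHeatKernel_nonneg hs hs1 ht w
    have h4 := Real.exp_pos (-‖w‖ ^ 2)
    nlinarith
  have h2 : ∫ w in (A m)ᶜ, fracHeatKernel n s w t * (1 - Real.exp (-‖w‖ ^ 2)) ≤
      t * (C * ∫ w in (A m)ᶜ, k w) := by
    rw [← integral_const_mul, ← integral_const_mul]
    refine setIntegral_mono_ae hi.integrableOn ((hk.const_mul C).const_mul t).integrableOn ?_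
    filter_upwards [Measure.ae_ne volume (0 : EuclideanSpace ℝ (Fin n))] with w hw
    have h3 := hCt t ht w hw
    have h4 := one_sub_exp_neg_norm_sq_nonneg w
    calc _ ≤ C * t * (1 / ‖w‖ ^ ((n : ℝ) + 2 * s)) * (1 - Real.exp (-‖w‖ ^ 2)) := by gcongr
      _ = _ := by rw [hkdef]; ring
  have h3 := hct t ht ht1
  have h4 : t * (C * ∫ w in (A m)ᶜ, k w) ≤ t * (c / 2) := by gcongr
  have h5 : c / 2 * t ≤ fracHeatKernel n s z t * v := by linarith
  rw [div_mul_eq_mul_div, div_le_iff₀ (by positivity)]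
  have := fracHeatKernel_nonneg hs hs1 ht z
  linarith

/-- The lower bound `P^s(z,t) ≥ c t |z|^{-n-2s}` for small `t`, by scaling `z` onto the sphere of radius
`a` on which `exists_le_fracHeatKernel_of_norm_le` applies. -/
theorem exists_eventually_le_fracHeatKernel (n : ℕ) [NeZero n] {s : ℝ} (hs : 0 < s)
    (hs2 : s < 1 / 2) : ∃ c : ℝ, 0 < c ∧ ∀ z : EuclideanSpace ℝ (Fin n), z ≠ 0 →
      ∀ᶠ t : ℝ in 𝓝[>] 0, c * t * (1 / ‖z‖ ^ ((n : ℝ) + 2 * s)) ≤ fracHeatKernel n s z t := by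
  obtain ⟨a, c, ha, hc, h⟩ := exists_le_fracHeatKernel_of_norm_le n hs hs2
  refine ⟨c * a ^ ((n : ℝ) + 2 * s), by positivity, fun z hz => ?_⟩
  have hz0 : 0 < ‖z‖ := norm_pos_iff.2 hz
  set r := ‖z‖ / a with hr
  have hr0 : 0 < r := by positivity
  have hr2 : 0 < r ^ (2 * s) := by positivity
  filter_upwards [Ioc_mem_nhdsGT hr2] with t ht
  have ht0 : 0 < t := ht.1
  have hscale := fracHeatKernel_smul (n := n) (s := s) hr0 (t / r ^ (2 * s)) (r⁻¹ • z)
  rw [smul_inv_smul₀ hr0.ne', mul_div_cancel₀ _ hr2.ne'] at hscale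
  have hb := h (t / r ^ (2 * s)) (by positivity) ((div_le_one hr2).2 ht.2) (r⁻¹ • z) (by
    rw [norm_smul, norm_inv, Real.norm_of_nonneg hr0.le, hr]
    apply le_of_eq
    field_simp)
  rw [hscale]
  calc _ = (r ^ n)⁻¹ * (c * (t / r ^ (2 * s))) := by
        have : ‖z‖ = a * r := by rw [hr]; field_simp
        rw [this, Real.mul_rpow ha.le hr0.le, Real.rpow_add hr0, Real.rpow_natCast]
        field_simp
    _ ≤ _ := by gcongr

end LowerBound

/-! ### The initial condition -/

theorem tendsto_integral_fracHeatKernel_mul {n : ℕ} [NeZero n] {s : ℝ} (hs : 0 < s) (hs1 : s < 1)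
    (φ : BoundedContinuousFunction (EuclideanSpace ℝ (Fin n)) ℝ) :
    Tendsto (fun t : ℝ => ∫ z, fracHeatKernel n s z t * φ z) (𝓝[>] 0) (𝓝 (φ 0)) := by
  obtain ⟨hi, h1⟩ := integrable_fracHeatKernel_and_integral (n := n) hs hs1 one_pos
  have hlim : Tendsto (fun t : ℝ => ∫ w, fracHeatKernel n s w 1 * φ (t ^ (2 * s)⁻¹ • w)) (𝓝[>] 0)
      (𝓝 (∫ w, fracHeatKernel n s w 1 * φ 0)) := by
    refine tendsto_integral_filter_of_dominated_convergence
      (fun w => fracHeatKernel n s w 1 * ‖φ‖) (Eventually.of_forall fun t => ?_)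
      (Eventually.of_forall fun t => Eventually.of_forall fun w => ?_) (hi.mul_const _)
      (Eventually.of_forall fun w => Tendsto.const_mul _ ?_)
    · exact hi.aestronglyMeasurable.mul (Continuous.aestronglyMeasurable (by fun_prop))
    · rw [norm_mul, Real.norm_of_nonneg (fracHeatKernel_nonneg hs hs1 one_pos w)]
      exact mul_le_mul_of_nonneg_left (φ.norm_coe_le_norm _)
        (fracHeatKernel_nonneg hs hs1 one_pos w)
    · have h2 : Tendsto (fun t : ℝ => t ^ (2 * s)⁻¹) (𝓝[>] 0) (𝓝 0) := by
        have := (Real.continuous_rpow_const (by positivity : 0 ≤ (2 * s)⁻¹)).tendsto 0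
        rw [Real.zero_rpow (by positivity)] at this
        exact this.mono_left nhdsWithin_le_nhds
      have h3 := h2.smul_const w
      rw [zero_smul] at h3
      exact (φ.continuous.tendsto 0).comp h3
  rw [integral_mul_const, h1, one_mul] at hlim
  refine hlim.congr' ?_
  filter_upwards [self_mem_nhdsWithin] with t ht
  have ht : (0 : ℝ) < t := ht
  set c := t ^ (2 * s)⁻¹ with hc
  have hc0 : 0 < c := by positivity
  have hct : c ^ (2 * s) = t := by
    rw [hc, ← Real.rpow_mul ht.le, inv_mul_cancel₀ (by positivity), Real.rpow_one]
  have hsub := Measure.integral_comp_smul (volume : Measure (EuclideanSpace ℝ (Fin n)))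
    (fun z => fracHeatKernel n s z t * φ z) c
  rw [abs_of_nonneg (by positivity), finrank_euclideanSpace_fin, smul_eq_mul] at hsub
  have hP : ∀ w : EuclideanSpace ℝ (Fin n),
      fracHeatKernel n s (c • w) t = (c ^ n)⁻¹ * fracHeatKernel n s w 1 := by
    intro w
    have := fracHeatKernel_smul (n := n) (s := s) hc0 1 w
    rwa [mul_one, hct] at this
  simp only [hP, mul_assoc] at hsub
  rw [integral_const_mul] at hsub
  exact mul_left_cancel₀ (by positivity) hsub

/-! ### The symbol of the fractional Laplacian -/

section Symbol

variable {n : ℕ} [NeZero n] {s : ℝ}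

/-- Integrability near the origin uses `2s < 1`, and near infinity `s > 0`. -/
theorem integrable_min_one_norm_div (n : ℕ) [NeZero n] (hs : 0 < s) (hs2 : s < 1 / 2) :
    Integrable fun h : EuclideanSpace ℝ (Fin n) => min 1 ‖h‖ / ‖h‖ ^ ((n : ℝ) + 2 * s) := by
  have hfr : (Module.finrank ℝ (EuclideanSpace ℝ (Fin n)) : ℝ) = n := by simp
  exact integrable_min_one_norm_div_rpow (by rw [hfr]; linarith) (by rw [hfr]; linarith)

theorem min_two_norm_mul_norm_le {E : Type*} [NormedAddCommGroup E] (ξ h : E) :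
    min 2 (‖ξ‖ * ‖h‖) ≤ 2 * (1 + ‖ξ‖) * min 1 ‖h‖ := by
  have h1 := norm_nonneg ξ
  have h2 := norm_nonneg h
  rcases le_total 1 ‖h‖ with h3 | h3
  · rw [min_eq_left h3]
    exact (min_le_left _ _).trans (by linarith)
  · rw [min_eq_right h3]
    exact (min_le_right _ _).trans (by nlinarith)

theorem abs_cos_inner_sub_cos_inner_le {E : Type*} [NormedAddCommGroup E] [InnerProductSpace ℝ E]
    (ξ z y : E) : |Real.cos (inner ℝ ξ z) - Real.cos (inner ℝ ξ y)| ≤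
      2 * (1 + ‖ξ‖) * min 1 ‖z - y‖ := by
  refine le_trans (le_min ?_ ?_) (min_two_norm_mul_norm_le ξ (z - y))
  · refine (abs_sub _ _).trans ?_
    linarith [Real.abs_cos_le_one (inner ℝ ξ z), Real.abs_cos_le_one (inner ℝ ξ y)]
  · refine (Real.abs_cos_sub_cos_le _ _).trans ?_
    rw [← inner_sub_right]
    exact abs_real_inner_le_norm _ _

theorem integrable_one_sub_cos_div (hs : 0 < s) (hs2 : s < 1 / 2) (ξ : EuclideanSpace ℝ (Fin n)) :
    Integrable fun h : EuclideanSpace ℝ (Fin n) =>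
      (1 - Real.cos (inner ℝ ξ h)) / ‖h‖ ^ ((n : ℝ) + 2 * s) := by
  refine ((integrable_min_one_norm_div n hs hs2).const_mul (2 * (1 + ‖ξ‖))).mono'
    (Measurable.aestronglyMeasurable (by fun_prop)) (Eventually.of_forall fun h => ?_)
  have h1 := abs_cos_inner_sub_cos_inner_le ξ 0 h
  rw [inner_zero_right, Real.cos_zero, zero_sub, norm_neg] at h1
  rw [norm_div, Real.norm_eq_abs, Real.norm_of_nonneg (by positivity), ← mul_div_assoc]
  gcongr

theorem integrable_sin_div (hs : 0 < s) (hs2 : s < 1 / 2) (ξ : EuclideanSpace ℝ (Fin n)) :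
    Integrable fun h : EuclideanSpace ℝ (Fin n) =>
      Real.sin (inner ℝ ξ h) / ‖h‖ ^ ((n : ℝ) + 2 * s) := by
  refine ((integrable_min_one_norm_div n hs hs2).const_mul (2 * (1 + ‖ξ‖))).mono'
    (Measurable.aestronglyMeasurable (by fun_prop)) (Eventually.of_forall fun h => ?_)
  rw [norm_div, Real.norm_eq_abs, Real.norm_of_nonneg (by positivity), ← mul_div_assoc]
  gcongr
  refine le_trans (le_min ?_ ?_) (min_two_norm_mul_norm_le ξ h)
  · linarith [Real.abs_sin_le_one (inner ℝ ξ h)]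
  · exact Real.abs_sin_le_abs.trans (abs_real_inner_le_norm _ _)

theorem integral_sin_div {n : ℕ} {s : ℝ} (ξ : EuclideanSpace ℝ (Fin n)) :
    ∫ h : EuclideanSpace ℝ (Fin n), Real.sin (inner ℝ ξ h) / ‖h‖ ^ ((n : ℝ) + 2 * s) = 0 := by
  have h1 := integral_neg_eq_self (fun h : EuclideanSpace ℝ (Fin n) =>
    Real.sin (inner ℝ ξ h) / ‖h‖ ^ ((n : ℝ) + 2 * s)) volume
  simp only [inner_neg_right, Real.sin_neg, norm_neg, neg_div, integral_neg] at h1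
  linarith

/-- Rotation and dilation invariance reduce the symbol of the fractional Laplacian to its value in
the first coordinate direction. -/
theorem integral_one_sub_cos_div (hs : 0 < s) (ξ : EuclideanSpace ℝ (Fin n)) :
    ∫ h : EuclideanSpace ℝ (Fin n), (1 - Real.cos (inner ℝ ξ h)) / ‖h‖ ^ ((n : ℝ) + 2 * s) =
      ‖ξ‖ ^ (2 * s) * ∫ h : EuclideanSpace ℝ (Fin n),
        (1 - Real.cos (h 0)) / ‖h‖ ^ ((n : ℝ) + 2 * s) := by
  rcases eq_or_ne ξ 0 with rfl | hξ
  · simp [Real.zero_rpow (by positivity : 2 * s ≠ 0)]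
  have hc : 0 < ‖ξ‖ := norm_pos_iff.2 hξ
  set e : EuclideanSpace ℝ (Fin n) := EuclideanSpace.single 0 1 with he
  set v : EuclideanSpace ℝ (Fin n) := ‖ξ‖ • e with hv
  have hvn : ‖ξ‖ = ‖v‖ := by
    rw [hv, norm_smul, norm_norm, he, PiLp.norm_single, norm_one, mul_one]
  have hR : (Submodule.span ℝ {ξ - v})ᗮ.reflection ξ = v := Submodule.reflection_sub hvn
  set R := (Submodule.span ℝ {ξ - v})ᗮ.reflection with hRdef
  have h1 := R.measurePreserving.integral_comp R.toHomeomorph.measurableEmbedding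
    (fun h : EuclideanSpace ℝ (Fin n) =>
      (1 - Real.cos (inner ℝ v h)) / ‖h‖ ^ ((n : ℝ) + 2 * s))
  have h2 : ∀ h, inner ℝ v (R h) = inner ℝ ξ h := by
    intro h
    rw [← hR, R.inner_map_map]
  simp only [h2, R.norm_map] at h1
  rw [h1]
  have h3 : ∀ h : EuclideanSpace ℝ (Fin n), inner ℝ v h = ‖ξ‖ * h 0 := by
    intro h
    rw [hv, real_inner_smul_left, he, EuclideanSpace.inner_single_left]
    simp
  simp only [h3]
  have h4 := Measure.integral_comp_smul (volume : Measure (EuclideanSpace ℝ (Fin n)))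
    (fun h => (1 - Real.cos (h 0)) / ‖h‖ ^ ((n : ℝ) + 2 * s)) ‖ξ‖
  rw [abs_of_nonneg (by positivity), finrank_euclideanSpace_fin, smul_eq_mul,
    inv_mul_eq_div, eq_div_iff (by positivity)] at h4
  rw [← h4, ← integral_mul_const, ← integral_const_mul]
  refine integral_congr_ae (Eventually.of_forall fun h => ?_)
  simp only [PiLp.smul_apply, smul_eq_mul, norm_smul, norm_norm]
  rw [Real.mul_rpow hc.le (norm_nonneg _), Real.rpow_add hc, Real.rpow_natCast]
  field_simp

theorem integral_one_sub_cos_coord_div_pos (n : ℕ) [NeZero n] (hs : 0 < s) (hs2 : s < 1 / 2) :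
    0 < ∫ h : EuclideanSpace ℝ (Fin n), (1 - Real.cos (h 0)) / ‖h‖ ^ ((n : ℝ) + 2 * s) := by
  have hI : Integrable fun h : EuclideanSpace ℝ (Fin n) =>
      (1 - Real.cos (h 0)) / ‖h‖ ^ ((n : ℝ) + 2 * s) := by
    have := integrable_one_sub_cos_div hs hs2
      (EuclideanSpace.single 0 1 : EuclideanSpace ℝ (Fin n))
    simpa [EuclideanSpace.inner_single_left] using this
  rw [integral_pos_iff_support_of_nonneg _ hI]
  · set U : Set (EuclideanSpace ℝ (Fin n)) := {h | Real.cos (h 0) < 0} with hU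
    have hUo : IsOpen U := isOpen_lt (by fun_prop) continuous_const
    have hUn : U.Nonempty := ⟨EuclideanSpace.single 0 Real.pi, by simp [hU]⟩
    refine (hUo.measure_pos volume hUn).trans_le (measure_mono fun h hh => ?_)
    have hh : Real.cos (h 0) < 0 := hh
    have h0 : h ≠ 0 := by
      rintro rfl
      simp at hh
      linarith
    have h1 : 0 < ‖h‖ := norm_pos_iff.2 h0
    have h2 : 0 < 1 - Real.cos (h 0) := by linarith
    exact (by positivity : 0 < (1 - Real.cos (h 0)) / ‖h‖ ^ ((n : ℝ) + 2 * s)).ne'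
  · intro h
    have : 0 ≤ 1 - Real.cos (h 0) := by linarith [Real.cos_le_one (h 0)]
    simp only [Pi.zero_apply]
    positivity

/-- Plane waves diagonalize the fractional Laplacian. -/
theorem integral_cos_inner_sub_cos_inner_div (hs : 0 < s) (hs2 : s < 1 / 2)
    (ξ z : EuclideanSpace ℝ (Fin n)) :
    ∫ y : EuclideanSpace ℝ (Fin n),
        (Real.cos (inner ℝ ξ z) - Real.cos (inner ℝ ξ y)) / ‖z - y‖ ^ ((n : ℝ) + 2 * s) =
      Real.cos (inner ℝ ξ z) * (‖ξ‖ ^ (2 * s) * ∫ h : EuclideanSpace ℝ (Fin n),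
        (1 - Real.cos (h 0)) / ‖h‖ ^ ((n : ℝ) + 2 * s)) := by
  rw [← integral_one_sub_cos_div hs ξ, ← integral_const_mul]
  have h1 := integral_sub_left_eq_self (fun y : EuclideanSpace ℝ (Fin n) =>
    (Real.cos (inner ℝ ξ z) - Real.cos (inner ℝ ξ y)) / ‖z - y‖ ^ ((n : ℝ) + 2 * s)) volume z
  rw [← h1]
  have h2 : ∀ h : EuclideanSpace ℝ (Fin n),
      (Real.cos (inner ℝ ξ z) - Real.cos (inner ℝ ξ (z - h))) / ‖z - (z - h)‖ ^ ((n : ℝ) + 2 * s) =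
      Real.cos (inner ℝ ξ z) * ((1 - Real.cos (inner ℝ ξ h)) / ‖h‖ ^ ((n : ℝ) + 2 * s)) -
        Real.sin (inner ℝ ξ z) * (Real.sin (inner ℝ ξ h) / ‖h‖ ^ ((n : ℝ) + 2 * s)) := by
    intro h
    rw [sub_sub_cancel, inner_sub_right, Real.cos_sub]
    ring
  simp only [h2]
  rw [integral_sub ((integrable_one_sub_cos_div hs hs2 ξ).const_mul _)
    ((integrable_sin_div hs hs2 ξ).const_mul _), integral_const_mul (Real.sin _),
    integral_sin_div, mul_zero, sub_zero]

end Symbol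

/-! ### The fractional heat equation -/

section Equation

variable {n : ℕ} [NeZero n] {s : ℝ}

/-- Joint absolute integrability behind `(-Δ)^s` of a cosine transform: the difference of cosines is at
most `2 (1 + |ξ|) min(1, |z - y|)`. -/
theorem integrable_fracLaplacian_cosTransform (hs : 0 < s) (hs2 : s < 1 / 2)
    {F : EuclideanSpace ℝ (Fin n) → ℝ} (hF : Integrable F) (hm : Measurable F)
    (hF1 : Integrable fun ξ => ‖ξ‖ * F ξ) (z : EuclideanSpace ℝ (Fin n)) :
    Integrable (Function.uncurry fun (y ξ : EuclideanSpace ℝ (Fin n)) =>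
      (Real.cos (inner ℝ ξ z) - Real.cos (inner ℝ ξ y)) / ‖z - y‖ ^ ((n : ℝ) + 2 * s) * F ξ)
      (volume.prod volume) := by
  have h1 := (integrable_min_one_norm_div n hs hs2).comp_sub_left z
  have h2 : Integrable fun ξ => 2 * ((1 + ‖ξ‖) * |F ξ|) := by
    refine Integrable.const_mul ((hF.abs.add hF1.abs).congr (Eventually.of_forall fun ξ => ?_)) 2
    simp only [Pi.add_apply, abs_mul, abs_norm]
    ring
  refine (h1.mul_prod h2).mono' ?_ (Eventually.of_forall fun p => ?_)
  · apply Measurable.aestronglyMeasurable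
    unfold Function.uncurry
    fun_prop
  · simp only [Function.uncurry]
    rw [norm_mul, norm_div, Real.norm_eq_abs, Real.norm_eq_abs (F p.2),
      Real.norm_of_nonneg (by positivity : 0 ≤ ‖z - p.1‖ ^ ((n : ℝ) + 2 * s))]
    calc _ ≤ 2 * (1 + ‖p.2‖) * min 1 ‖z - p.1‖ / ‖z - p.1‖ ^ ((n : ℝ) + 2 * s) * |F p.2| := by
          gcongr
          exact abs_cos_inner_sub_cos_inner_le p.2 z p.1
      _ = _ := by ring

theorem fracLaplacian_cosTransform_integrand {n : ℕ} {s : ℝ}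
    {F : EuclideanSpace ℝ (Fin n) → ℝ} (hF : Integrable F) (z y : EuclideanSpace ℝ (Fin n)) :
    (cosTransform F z - cosTransform F y) / ‖z - y‖ ^ ((n : ℝ) + 2 * s) =
      ∫ ξ, (Real.cos (inner ℝ ξ z) - Real.cos (inner ℝ ξ y)) / ‖z - y‖ ^ ((n : ℝ) + 2 * s) *
        F ξ := by
  rw [cosTransform, cosTransform,
    ← integral_sub (integrable_cos_inner_mul hF z) (integrable_cos_inner_mul hF y),
    ← integral_div]
  refine integral_congr_ae (Eventually.of_forall fun ξ => ?_)
  simp only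
  ring

theorem fracLaplacian_cosTransform (hs : 0 < s) (hs2 : s < 1 / 2)
    {F : EuclideanSpace ℝ (Fin n) → ℝ} (hF : Integrable F) (hm : Measurable F)
    (hF1 : Integrable fun ξ => ‖ξ‖ * F ξ) (z : EuclideanSpace ℝ (Fin n)) :
    fracLaplacian n s (cosTransform F) z = cosTransform (fun ξ => ‖ξ‖ ^ (2 * s) * F ξ) z := by
  have hK := integral_one_sub_cos_coord_div_pos n hs hs2
  rw [fracLaplacian, fracLaplacianConst]
  simp only [fracLaplacian_cosTransform_integrand hF]
  rw [integral_integral_swap (integrable_fracLaplacian_cosTransform hs hs2 hF hm hF1 z)]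
  simp only [integral_mul_const, integral_cos_inner_sub_cos_inner_div hs hs2]
  rw [← integral_const_mul, cosTransform]
  refine integral_congr_ae (Eventually.of_forall fun ξ => ?_)
  simp only
  field_simp

theorem integrable_exp_neg_and_norm_mul (n : ℕ) [NeZero n] (hs : 0 < s) {t : ℝ} (ht : 0 < t) :
    Integrable (fun ξ : EuclideanSpace ℝ (Fin n) => Real.exp (-t * ‖ξ‖ ^ (2 * s))) ∧
      Integrable fun ξ : EuclideanSpace ℝ (Fin n) => ‖ξ‖ * Real.exp (-t * ‖ξ‖ ^ (2 * s)) := by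
  have hp : 0 < 2 * s := by positivity
  refine ⟨integrable_exp_neg_mul_norm_rpow ht hp, ?_⟩
  simpa using integrable_norm_rpow_mul_exp_neg (E := EuclideanSpace ℝ (Fin n)) ht hp zero_le_one

theorem integrable_fracLaplacian_fracHeatKernel (hs : 0 < s) (hs2 : s < 1 / 2) {t : ℝ}
    (ht : 0 < t) (z : EuclideanSpace ℝ (Fin n)) :
    Integrable fun y => (fracHeatKernel n s z t - fracHeatKernel n s y t) /
      ‖z - y‖ ^ ((n : ℝ) + 2 * s) := by
  obtain ⟨hF, hF1⟩ := integrable_exp_neg_and_norm_mul n hs ht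
  have h := (integrable_fracLaplacian_cosTransform hs hs2 hF (by fun_prop) hF1 z).integral_prod_left
  refine (h.const_mul ((2 * Real.pi) ^ n)⁻¹).congr (Eventually.of_forall fun y => ?_)
  simp only [Function.uncurry]
  rw [← fracLaplacian_cosTransform_integrand hF, fracHeatKernel_eq_cosTransform,
    fracHeatKernel_eq_cosTransform]
  ring

theorem fracLaplacian_fracHeatKernel (hs : 0 < s) (hs2 : s < 1 / 2) {t : ℝ} (ht : 0 < t)
    (z : EuclideanSpace ℝ (Fin n)) :
    fracLaplacian n s (fun y => fracHeatKernel n s y t) z = ((2 * Real.pi) ^ n)⁻¹ *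
      cosTransform (fun ξ => ‖ξ‖ ^ (2 * s) * Real.exp (-t * ‖ξ‖ ^ (2 * s))) z := by
  obtain ⟨hF, hF1⟩ := integrable_exp_neg_and_norm_mul n hs ht
  rw [← fracLaplacian_cosTransform hs hs2 hF (by fun_prop) hF1 z]
  simp only [fracLaplacian, fracHeatKernel_eq_cosTransform]
  rw [mul_left_comm]
  congr 1
  rw [← integral_const_mul]
  refine integral_congr_ae (Eventually.of_forall fun y => ?_)
  simp only
  ring

theorem hasDerivAt_fracHeatKernel (hs : 0 < s) (hs2 : s < 1 / 2) {t : ℝ} (ht : 0 < t)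
    (z : EuclideanSpace ℝ (Fin n)) :
    HasDerivAt (fun τ => fracHeatKernel n s z τ)
      (-fracLaplacian n s (fun y => fracHeatKernel n s y t) z) t := by
  have hp : 0 < 2 * s := by positivity
  have ht2 : 0 < t / 2 := by positivity
  have h := hasDerivAt_integral_of_dominated_loc_of_deriv_le
    (μ := (volume : Measure (EuclideanSpace ℝ (Fin n)))) (x₀ := t) (s := Set.Ioi (t / 2))
    (F := fun τ ξ => Real.cos (inner ℝ ξ z) * Real.exp (-τ * ‖ξ‖ ^ (2 * s)))
    (F' := fun τ ξ => Real.cos (inner ℝ ξ z) *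
      (Real.exp (-τ * ‖ξ‖ ^ (2 * s)) * -‖ξ‖ ^ (2 * s)))
    (bound := fun ξ => ‖ξ‖ ^ (2 * s) * Real.exp (-(t / 2) * ‖ξ‖ ^ (2 * s)))
    (Ioi_mem_nhds (by linarith))
    (Eventually.of_forall fun τ => Measurable.aestronglyMeasurable (by fun_prop))
    (integrable_cos_inner_mul (integrable_exp_neg_mul_norm_rpow ht hp) z)
    (Measurable.aestronglyMeasurable (by fun_prop))
    (Eventually.of_forall fun ξ τ hτ => ?_)
    (integrable_norm_rpow_mul_exp_neg ht2 hp hp.le)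
    (Eventually.of_forall fun ξ τ hτ => ?_)
  · have h2 := h.2.const_mul (((2 * Real.pi) ^ n)⁻¹)
    rw [fracLaplacian_fracHeatKernel hs hs2 ht]
    refine h2.congr_deriv ?_
    rw [cosTransform, ← mul_neg, ← integral_neg]
    congr 1
    refine integral_congr_ae (Eventually.of_forall fun ξ => ?_)
    simp only
    ring
  · have hτ : t / 2 < τ := hτ
    rw [norm_mul, norm_mul, norm_neg, Real.norm_of_nonneg (Real.exp_nonneg _),
      Real.norm_of_nonneg (by positivity : 0 ≤ ‖ξ‖ ^ (2 * s)), mul_comm (Real.exp _)]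
    refine (mul_le_of_le_one_left (by positivity) (Real.abs_cos_le_one _)).trans ?_
    gcongr
  · refine HasDerivAt.const_mul _ (HasDerivAt.exp ?_)
    simpa using ((hasDerivAt_id τ).neg.mul_const (‖ξ‖ ^ (2 * s)))

end Equation

/-! ### Small-time energy and fractional perimeter -/

section Energy

variable {n : ℕ} [NeZero n] {s : ℝ}

/-- The upper kernel bound gives `𝓔ₜˢ(A) ≤ C t P_{2s}(A)`. -/
theorem limsup_fracHeatEnergy_lt_top (hs : 0 < s) (hs1 : s < 1)
    {A : Set (EuclideanSpace ℝ (Fin n))} (hA : fracPerimeter n s A < ⊤) :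
    limsup (fun t : ℝ => fracHeatEnergy n s t A / ENNReal.ofReal t) (𝓝[>] 0) < ⊤ := by
  obtain ⟨C, hC, hCt⟩ := exists_fracHeatKernel_le n hs hs1
  refine lt_of_le_of_lt ?_ (ENNReal.mul_lt_top (ENNReal.ofReal_lt_top (r := C)) hA)
  refine limsup_le_of_le (by isBoundedDefault) ?_
  filter_upwards [self_mem_nhdsWithin] with t ht
  have ht : (0 : ℝ) < t := ht
  have hCtop : ENNReal.ofReal (C * t) ≠ ⊤ := ENNReal.ofReal_ne_top
  have h : fracHeatEnergy n s t A ≤ ENNReal.ofReal (C * t) * fracPerimeter n s A := by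
    rw [fracHeatEnergy, fracPerimeter, ← lintegral_const_mul' _ _ hCtop]
    refine lintegral_mono fun x => ?_
    simp only
    rw [← lintegral_const_mul' _ _ hCtop]
    refine lintegral_mono_ae (ae_restrict_of_ae ?_)
    filter_upwards [Measure.ae_ne volume x] with y hy
    rw [← ENNReal.ofReal_mul (by positivity), norm_sub_rev y x]
    exact ENNReal.ofReal_le_ofReal (hCt t ht (x - y) (sub_ne_zero.2 hy.symm))
  rw [ENNReal.div_le_iff (ENNReal.ofReal_pos.2 ht).ne' ENNReal.ofReal_ne_top]
  refine h.trans (le_of_eq ?_)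
  rw [ENNReal.ofReal_mul hC.le]
  ring

/-- Fatou's lemma along `t → 0⁺`, applied in both variables, with the lower kernel bound. -/
theorem fracPerimeter_lt_top (hs : 0 < s) (hs2 : s < 1 / 2) {A : Set (EuclideanSpace ℝ (Fin n))}
    (hA : limsup (fun t : ℝ => fracHeatEnergy n s t A / ENNReal.ofReal t) (𝓝[>] 0) < ⊤) :
    fracPerimeter n s A < ⊤ := by
  obtain ⟨c, hc, hct⟩ := exists_eventually_le_fracHeatKernel n hs hs2
  have hctop : ENNReal.ofReal c ≠ ⊤ := ENNReal.ofReal_ne_top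
  -- the kernel is truncated to `t > 0`, so that it is measurable for every value of the parameter
  set f : ℝ → EuclideanSpace ℝ (Fin n) → EuclideanSpace ℝ (Fin n) → ENNReal := fun t x y =>
    if 0 < t then ENNReal.ofReal (fracHeatKernel n s (x - y) t) / ENNReal.ofReal t else 0 with hf
  have hfm : ∀ t, Measurable (Function.uncurry (f t)) := by
    intro t
    by_cases ht : 0 < t
    · have hP := (continuous_fracHeatKernel (n := n) hs ht).measurable
      have h2 : Measurable fun p : EuclideanSpace ℝ (Fin n) × EuclideanSpace ℝ (Fin n) =>
          fracHeatKernel n s (p.1 - p.2) t := hP.comp (by fun_prop)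
      simp only [hf, ht, if_true, Function.uncurry_def]
      exact h2.ennreal_ofReal.div_const _
    · simp only [hf, ht, if_false, Function.uncurry_def]
      exact measurable_const
  have hpt : ∀ x y : EuclideanSpace ℝ (Fin n), x ≠ y →
      ENNReal.ofReal c * ENNReal.ofReal (1 / ‖y - x‖ ^ ((n : ℝ) + 2 * s)) ≤
        liminf (fun t => f t x y) (𝓝[>] 0) := by
    intro x y hxy
    refine le_liminf_of_le (by isBoundedDefault) ?_
    filter_upwards [hct (x - y) (sub_ne_zero.2 hxy), self_mem_nhdsWithin] with t h1 ht
    have ht : (0 : ℝ) < t := ht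
    simp only [hf, ht, if_true]
    rw [ENNReal.le_div_iff_mul_le (Or.inl (ENNReal.ofReal_pos.2 ht).ne')
      (Or.inl ENNReal.ofReal_ne_top), ← ENNReal.ofReal_mul hc.le,
      ← ENNReal.ofReal_mul (by positivity), norm_sub_rev y x]
    refine ENNReal.ofReal_le_ofReal (le_trans (le_of_eq ?_) h1)
    ring
  have h1 : ENNReal.ofReal c * fracPerimeter n s A ≤
      liminf (fun t => ∫⁻ x in A, ∫⁻ y in Aᶜ, f t x y) (𝓝[>] 0) := by
    calc ENNReal.ofReal c * fracPerimeter n s A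
        ≤ ∫⁻ x in A, ∫⁻ y in Aᶜ, liminf (fun t => f t x y) (𝓝[>] 0) := by
          rw [fracPerimeter, ← lintegral_const_mul' _ _ hctop]
          refine lintegral_mono fun x => ?_
          simp only
          rw [← lintegral_const_mul' _ _ hctop]
          refine lintegral_mono_ae (ae_restrict_of_ae ?_)
          filter_upwards [Measure.ae_ne volume x] with y hy using hpt x y hy.symm
      _ ≤ ∫⁻ x in A, liminf (fun t => ∫⁻ y in Aᶜ, f t x y) (𝓝[>] 0) :=
          lintegral_mono fun x => lintegral_liminf_le fun t => (hfm t).of_uncurry_left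
      _ ≤ _ := lintegral_liminf_le fun t => (hfm t).lintegral_prod_right'
  have h2 : liminf (fun t => ∫⁻ x in A, ∫⁻ y in Aᶜ, f t x y) (𝓝[>] 0) ≤
      limsup (fun t : ℝ => fracHeatEnergy n s t A / ENNReal.ofReal t) (𝓝[>] 0) := by
    refine le_trans (liminf_le_limsup) (le_of_eq (limsup_congr ?_))
    filter_upwards [self_mem_nhdsWithin] with t ht
    have ht : (0 : ℝ) < t := ht
    have htop : (ENNReal.ofReal t)⁻¹ ≠ ⊤ := ENNReal.inv_ne_top.2 (ENNReal.ofReal_pos.2 ht).ne'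
    simp only [hf, ht, if_true, div_eq_mul_inv, fracHeatEnergy]
    rw [← lintegral_mul_const' _ _ htop]
    refine lintegral_congr fun x => ?_
    rw [lintegral_mul_const' _ _ htop]
  have h3 := (h1.trans h2).trans_lt hA
  by_contra hP
  rw [not_lt_top_iff.1 hP, ENNReal.mul_top (ENNReal.ofReal_pos.2 hc).ne'] at h3
  exact lt_irrefl _ h3

end Energy

/-! ### The fundamental solution and the energy criterion -/

theorem mainTheorem6 (n : ℕ) [NeZero n] (s : ℝ) (hs_pos : 0 < s) (hs_lt : s < 1 / 2) :
    IsFracHeatFundamentalSolution n s (fracHeatKernel n s) ∧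
      ∀ E : Set (EuclideanSpace ℝ (Fin n)), NullMeasurableSet E volume →
        (limsup (fun t : ℝ => fracHeatEnergy n s t E / ENNReal.ofReal t) (𝓝[>] 0) < ⊤ ↔
          fracPerimeter n s E < ⊤) := by
  have hs1 : s < 1 := by linarith
  refine ⟨⟨fun t ht z => fracHeatKernel_nonneg hs_pos hs1 ht z,
    fun t ht => (integrable_fracHeatKernel_and_integral hs_pos hs1 ht).1,
    fun t ht => (integrable_fracHeatKernel_and_integral hs_pos hs1 ht).2,
    fun t ht z => integrable_fracLaplacian_fracHeatKernel hs_pos hs_lt ht z,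
    fun t ht z => hasDerivAt_fracHeatKernel hs_pos hs_lt ht z,
    fun φ => tendsto_integral_fracHeatKernel_mul hs_pos hs1 φ⟩, fun E _ => ?_⟩
  exact ⟨fracPerimeter_lt_top hs_pos hs_lt, limsup_fracHeatEnergy_lt_top hs_pos hs1⟩
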